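/- Let $L$ be a finite-dimensional Lie algebra over a field. **$L$-algebras.** An $L$-algebra is a Lie algebra $A$ with a homomorphism $L\to\operatorname{Der}A$, $x\mapsto(a\mapsto x.a)$; it is irreducible if it is irreducible as an $L$-module. Ideals and factors $H/K$ ($K\subseteq H$ ideals of $L$) are $L$-algebras in the natural way. Write $A\sim_L B$ if there is an isomorphism $A\rtimes L\to B\rtimes L$ mapping $A$ into $B$ and inducing the identity on $L$. Put $C_L(A)=\{x\in L: x.a=0\ \forall a\in A\}$ and $I_L(A)=\{x\in L:\exists a\in A\ \forall b\in A,\ x.b=[a,b]\}$. Let $Z^1(L,A)$ be the set of linear maps $\alpha:L\to A$ with $\alpha([x,y])=x.\alpha(y)-y.\alpha(x)+[\alpha(x),\alpha(y)]$, let $E_L(A)=\{x\in L:\alpha(x)=0\ \forall\alpha\in Z^1(L,A)\}$, and let $E_L(A)_{A\rtimes L}$ be the largest ideal of $A\rtimes L$ contained in $E_L(A)\subseteq L\subseteq A\rtimes L$. The Frattini ideal $\phi(M)$ of a Lie algebra $M$ is the largest ideal of $M$ contained in all its maximal subalgebras; a factor $H/K$ is Frattini if $H/K\subseteq\phi(L/K)$.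 With $I=I_L(A)$ put $$D_L(A)=\bigcap\{R : R\subseteq I \text{ an ideal of } L,\ A\sim_L I/R,\ I/R\text{ non-Frattini}\}$$ (read as $L$ if there is no such $R$). A Lie algebra is primitive if it has a maximal subalgebra containing no nonzero ideal, and primitive of type $2$ if moreover it has a unique minimal ideal and this ideal is nonabelian; $\operatorname{Soc}$ denotes the sum of the minimal ideals. The primitive epimorphic images of $L$ corresponding to $A$ are the primitive quotients $P=L/R$ with $R$ as in the definition of $D_L(A)$. **Chief factors.** $H/K$ is a chief factor of $L$ if it is a minimal ideal of $L/K$. A subalgebra $M$ is a supplement of $H/K$ if $L=H+M$ and $K\subseteq H\cap M$, and a complement if $L=H+M$ and $H\cap M=K$; a chief factor is supplemented if it has a supplement $M\neq L$. A chief factor is a $c$-factor if it has a complement, and a $c'$-factor otherwise; it is an $m'$-factor if no maximal subalgebra of $L$ is a complement of it. Write $A/B\searrow C/D$ (or $C/D\swarrow A/B$) if $A=B+C$ and $B\cap C=D$. An $m$-crossing $[A/B\searrow C/D]$ consists of chief factors with $A/B\searrow C/D$, $A/B$ Frattini, and $C/D$ supplemented by a maximal subalgebra of $L$. Chief factors $A/B$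 and $C/D$ are $m$-related if one of the following holds: (1) $A/B\swarrow R/S\searrow C/D$ for a supplemented chief factor $R/S$; (2) $A/B\swarrow V/X$ and $W/X\searrow C/D$ for an $m$-crossing $[U/V\searrow W/X]$; (3) $A/B\searrow Y/Z\swarrow C/D$ for a Frattini chief factor $Y/Z$; (4) $A/B\searrow U/V$ and $U/W\swarrow C/D$ for an $m$-crossing $[U/V\searrow W/X]$. **$cc'$-type.** An irreducible $L$-algebra $A$ is of $cc'$-type in $L$ if there are two chief series $0=X_0<\dots<X_n=L$ and $0=Y_0<\dots<Y_n=L$ of $L$ and a permutation $\pi$ of $\{1,\dots,n\}$ such that $X_j/X_{j-1}$ and $Y_{\pi(j)}/Y_{\pi(j)-1}$ are $m$-related for all $j$, and an index $i$ such that $A\sim_L X_i/X_{i-1}$, the factors $X_i/X_{i-1}$ and $Y_{\pi(i)}/Y_{\pi(i)-1}$ are nonabelian $m'$-factors, one of them is a $c'$-factor $F$ and the other one is a $c$-factor $A_1/A_0$, and there are a $c'$-factor $B_1/B_0$ with $F\swarrow B_1/B_0\searrow A_1/A_0$ and ideals $I=I_L(A_1/A_0)$, $C=C_L(A_1/A_0)$,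 $X$, $N$ of $L$ with: (i) $I/C\searrow B_1/B_0$ and $I/C$ is a $c'$-factor; (ii) $X\subseteq I$, $N=X\cap C$, $X/N\searrow A_1/A_0$, $I/C\searrow X/N$, and $X/N$ is a $c$-factor; (iii) there is a supplement $F_0$ of $I/C$ in $L$ such that $L/N$ is isomorphic to the natural semidirect sum of $I/C$ by $F_0/C$; (iv) $L/C$ is primitive of type $2$ and $\operatorname{Soc}(L/C)=I/C$. **Theorem.** Let $A$ be a nonabelian irreducible $L$-algebra. Then $A$ is of $cc'$-type in $L$ if and only if $$E_L(A)_{A\rtimes L}\subset D_L(A)\subset I_L(A)\quad\text{(strict inclusions)}$$ and $\operatorname{Soc}(P)$ is a $c'$-factor of $P$, where $P$ is the corresponding primitive epimorphic image of $L$. (This holds both when the last condition is required for some corresponding $P$ and when it is required for every corresponding $P$.) -/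

import Mathlib

namespace CCType

open LieAlgebra

variable {k : Type*} [Field k]

/-! ### Lie algebras with an action of `L` by derivations

An `L`-algebra is a Lie algebra `A` together with a homomorphism `θ : L → Der A`; the action
of `x : L` on `a : A` is `θ x a`. -/

section LAlgebra

variable {L : Type*} [LieRing L] [LieAlgebra k L]
variable {A : Type*} [LieRing A] [LieAlgebra k A]
variable {B : Type*} [LieRing B] [LieAlgebra k B]

/-- `A` is irreducible as an `L`-module. -/
def IsIrreducibleLAlgebra (θ : L →ₗ⁅k⁆ LieDerivation k A A) : Prop :=
  Nontrivial A ∧ ∀ W : Submodule k A, (∀ x : L, ∀ a ∈ W, θ x a ∈ W) → W = ⊥ ∨ W = ⊤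

/-- `L`-equivalence `A ∼_L B`: an isomorphism `A ⋊ L → B ⋊ L` that restricts to a map `A → B`
and induces the identity on `L`. -/
def LEquivalent (θ : L →ₗ⁅k⁆ LieDerivation k A A) (ψ : L →ₗ⁅k⁆ LieDerivation k B B) : Prop :=
  ∃ (Φ : SemiDirectSum A L θ ≃ₗ⁅k⁆ SemiDirectSum B L ψ) (φ : A →ₗ⁅k⁆ B),
    (∀ a, Φ (SemiDirectSum.inl θ a) = SemiDirectSum.inl ψ (φ a)) ∧
    ∀ y, SemiDirectSum.projr ψ (Φ y) = SemiDirectSum.projr θ y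

/-- The centralizer `C_L(A)`. -/
def centralizer (θ : L →ₗ⁅k⁆ LieDerivation k A A) : LieIdeal k L := θ.ker

/-- `I_L(A)`: the elements of `L` that act on `A` as an inner derivation. -/
def innerIdeal (θ : L →ₗ⁅k⁆ LieDerivation k A A) : LieIdeal k L where
  carrier := {x | ∃ a : A, ∀ b : A, θ x b = ⁅a, b⁆}
  add_mem' := by
    rintro x y ⟨a, ha⟩ ⟨c, hc⟩
    exact ⟨a + c, fun b => by simp [ha, hc]⟩
  zero_mem' := ⟨0, fun b => by simp⟩
  smul_mem' := by
    rintro t x ⟨a, ha⟩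
    exact ⟨t • a, fun b => by simp [ha]⟩
  lie_mem := by
    rintro y x ⟨a, ha⟩
    refine ⟨θ y a, fun b => ?_⟩
    rw [LieHom.map_lie, LieDerivation.commutator_apply, ha, ha,
      LieDerivation.apply_lie_eq_add]
    abel

/-- `α ∈ Z¹(L, A)`: a linear map with `α [x, y] = x.α(y) - y.α(x) + α(x) α(y)`. -/
def IsOneCocycle (θ : L →ₗ⁅k⁆ LieDerivation k A A) (α : L →ₗ[k] A) : Prop :=
  ∀ x y : L, α ⁅x, y⁆ = θ x (α y) - θ y (α x) + ⁅α x, α y⁆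

/-- `E_L(A)`: the common zeros of all 1-cocycles of `L` with values in `A`. -/
def cocycleZeros (θ : L →ₗ⁅k⁆ LieDerivation k A A) : LieSubalgebra k L where
  carrier := {x | ∀ α : L →ₗ[k] A, IsOneCocycle θ α → α x = 0}
  add_mem' := by
    intro x y hx hy α hα
    rw [map_add, hx α hα, hy α hα, add_zero]
  zero_mem' := fun α _ => map_zero α
  smul_mem' := by
    intro t x hx α hα
    rw [map_smul, hx α hα, smul_zero]
  lie_mem' := by
    intro x y hx hy α hα
    rw [hα x y, hx α hα, hy α hα]
    simp

end LAlgebra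

/-! ### Ideals, subalgebras, primitive Lie algebras -/

section General

variable (k) (M : Type*) [LieRing M] [LieAlgebra k M]

variable {k M} in
/-- The core of a subalgebra: the largest ideal contained in it. -/
def core (U : LieSubalgebra k M) : LieIdeal k M :=
  sSup {J : LieIdeal k M | ∀ x ∈ J, x ∈ U}

/-- The Frattini ideal: the largest ideal contained in all maximal subalgebras. -/
def frattiniIdeal : LieIdeal k M :=
  core (sInf {U : LieSubalgebra k M | IsCoatom U})

/-- The socle: the sum of all minimal ideals. -/
def socle : LieIdeal k M := sSup {J : LieIdeal k M | IsAtom J}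

/-- Primitive: there is a core-free maximal subalgebra. -/
def IsPrimitive : Prop := ∃ U : LieSubalgebra k M, IsCoatom U ∧ core U = ⊥

/-- Primitive of type 2: primitive with a unique minimal ideal, which is nonabelian. -/
def IsPrimitiveTypeTwo : Prop :=
  IsPrimitive k M ∧ ∃ J : LieIdeal k M, IsAtom J ∧ (∀ J' : LieIdeal k M, IsAtom J' → J' = J) ∧
    ¬ IsLieAbelian J

variable {k M}

/-- An ideal `J` of `M` as an `M`-algebra in the natural way. -/
def idealAction (J : LieIdeal k M) : M →ₗ⁅k⁆ LieDerivation k J J where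
  toFun x :=
    { toFun := fun a => ⟨⁅x, (a : M)⁆, J.lie_mem a.2⟩
      map_add' := fun a b => Subtype.ext (by simp)
      map_smul' := fun t a => Subtype.ext (by simp)
      leibniz' := fun a b => Subtype.ext (by
        change ⁅x, ⁅(a : M), (b : M)⁆⁆ = ⁅(a : M), ⁅x, (b : M)⁆⁆ - ⁅(b : M), ⁅x, (a : M)⁆⁆
        rw [leibniz_lie x (a : M) (b : M), ← lie_skew (b : M) ⁅x, (a : M)⁆]
        abel) }
  map_add' x y := by
    ext a
    exact add_lie x y (a : M)
  map_smul' t x := by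
    ext a
    exact smul_lie t x (a : M)
  map_lie' := by
    intro x y
    ext a
    rw [LieDerivation.commutator_apply]
    exact lie_lie x y (a : M)

end General

/-! ### Factors of `L` -/

section Factors

variable {L : Type*} [LieRing L] [LieAlgebra k L]

/-- The quotient homomorphism `L → L/K`. -/
def quotHom (K : LieIdeal k L) : L →ₗ⁅k⁆ L ⧸ K where
  toLinearMap := Submodule.mkQ K.toSubmodule
  map_lie' := by
    intro x y
    rfl

/-- The factor `H/K`, as the image of the ideal `H` in `L/K`. -/
def factor (H K : LieIdeal k L) : LieIdeal k (L ⧸ K) where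
  toSubmodule := H.toSubmodule.map (quotHom K : L →ₗ[k] L ⧸ K)
  lie_mem := by
    intro y z hz
    obtain ⟨h, hh, rfl⟩ := hz
    obtain ⟨x, rfl⟩ := Submodule.mkQ_surjective K.toSubmodule y
    exact ⟨⁅x, h⁆, H.lie_mem hh, (quotHom K).map_lie x h⟩

/-- The factor `H/K` as an `L`-algebra in the natural way. -/
def factorAction (H K : LieIdeal k L) :
    L →ₗ⁅k⁆ LieDerivation k (factor H K) (factor H K) :=
  (idealAction (factor H K)).comp (quotHom K)

/-- `H/K` is a chief factor of `L`. -/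
def IsChiefFactor (H K : LieIdeal k L) : Prop := K ≤ H ∧ IsAtom (factor H K)

/-- `H/K` is nonabelian. -/
def IsNonabelianFactor (H K : LieIdeal k L) : Prop := ¬ IsLieAbelian (factor H K)

/-- `H/K` is contained in the Frattini ideal of `L/K`. -/
def IsFrattiniFactor (H K : LieIdeal k L) : Prop := factor H K ≤ frattiniIdeal k (L ⧸ K)

/-- The subalgebra `M` is a supplement of `H/K` in `L`. -/
def IsSupplement (M : LieSubalgebra k L) (H K : LieIdeal k L) : Prop :=
  H.toSubmodule ⊔ M.toSubmodule = ⊤ ∧ K.toSubmodule ≤ H.toSubmodule ⊓ M.toSubmodule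

/-- The subalgebra `M` is a complement of `H/K` in `L`. -/
def IsComplement (M : LieSubalgebra k L) (H K : LieIdeal k L) : Prop :=
  H.toSubmodule ⊔ M.toSubmodule = ⊤ ∧ H.toSubmodule ⊓ M.toSubmodule = K.toSubmodule

/-- Supplemented chief factor. The supplement is proper: `M = L` would always qualify. -/
def IsSupplementedChiefFactor (H K : LieIdeal k L) : Prop :=
  IsChiefFactor H K ∧ ∃ M : LieSubalgebra k L, M ≠ ⊤ ∧ IsSupplement M H K

/-- `c`-factor: a chief factor complemented by a subalgebra. -/
def IsCFactor (H K : LieIdeal k L) : Prop :=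
  IsChiefFactor H K ∧ ∃ M : LieSubalgebra k L, IsComplement M H K

/-- `c'`-factor: a chief factor that is not a `c`-factor. -/
def IsCPrimeFactor (H K : LieIdeal k L) : Prop :=
  IsChiefFactor H K ∧ ¬ ∃ M : LieSubalgebra k L, IsComplement M H K

/-- `m'`-factor: a chief factor not complemented by any maximal subalgebra. -/
def IsMPrimeFactor (H K : LieIdeal k L) : Prop :=
  IsChiefFactor H K ∧ ¬ ∃ M : LieSubalgebra k L, IsCoatom M ∧ IsComplement M H K

/-- `A/B ↘ C/D`. -/
def Covers (A B C D : LieIdeal k L) : Prop := A = B ⊔ C ∧ B ⊓ C = D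

/-- The `m`-crossing `[A/B ↘ C/D]`. -/
def IsMCrossing (A B C D : LieIdeal k L) : Prop :=
  IsChiefFactor A B ∧ IsChiefFactor C D ∧ Covers A B C D ∧ IsFrattiniFactor A B ∧
    ∃ M : LieSubalgebra k L, IsCoatom M ∧ IsSupplement M C D

/-- The chief factors `A/B` and `C/D` are `m`-related. -/
def MRelated (A B C D : LieIdeal k L) : Prop :=
  (∃ R S : LieIdeal k L, IsSupplementedChiefFactor R S ∧ Covers R S A B ∧ Covers R S C D) ∨
  (∃ U V W X : LieIdeal k L, IsMCrossing U V W X ∧ Covers V X A B ∧ Covers W X C D) ∨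
  (∃ Y Z : LieIdeal k L, IsChiefFactor Y Z ∧ IsFrattiniFactor Y Z ∧
    Covers A B Y Z ∧ Covers C D Y Z) ∨
  (∃ U V W X : LieIdeal k L, IsMCrossing U V W X ∧ Covers A B U V ∧ Covers C D U W)

/-- `0 = X₀ < X₁ < ⋯ < Xₙ = L` is a chief series of `L`. -/
def IsChiefSeries {n : ℕ} (X : Fin (n + 1) → LieIdeal k L) : Prop :=
  X 0 = ⊥ ∧ X (Fin.last n) = ⊤ ∧ ∀ i : Fin n, IsChiefFactor (X i.succ) (X i.castSucc)

/-- For ideals `C ≤ I` and a subalgebra `F ≥ C`: the action of `F/C` on `I/C`, used to form the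
natural semidirect sum of `I/C` by `F/C`. -/
def subalgebraAction (I C : LieIdeal k L) (F : LieSubalgebra k L) :
    (F.map (quotHom C)) →ₗ⁅k⁆ LieDerivation k (factor I C) (factor I C) :=
  (idealAction (factor I C)).comp (F.map (quotHom C)).incl

/-- For a `c'`-factor `B₁/B₀` and a `c`-factor `A₁/A₀` with `B₁/B₀ ↘ A₁/A₀`: the ideals
`I = I_L(A₁/A₀)`, `C = C_L(A₁/A₀)`, `X`, `N` satisfy
(i) `I/C ↘ B₁/B₀` and `I/C` is a `c'`-factor;
(ii) `X ⊆ I`, `N = X ∩ C`, `X/N ↘ A₁/A₀`, `I/C ↘ X/N` and `X/N` is a `c`-factor;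
(iii) there is a supplement `F` of `I/C` in `L` with `L/N` isomorphic to the natural semidirect
sum of `I/C` by `F/C`;
(iv) `L/C` is primitive of type 2 with socle `I/C`. -/
def IsCrossingData (B₁ B₀ A₁ A₀ I C X N : LieIdeal k L) : Prop :=
  (I = innerIdeal (factorAction A₁ A₀) ∧ C = centralizer (factorAction A₁ A₀)) ∧
  (Covers I C B₁ B₀ ∧ IsCPrimeFactor I C) ∧
  (X ≤ I ∧ N = X ⊓ C ∧ Covers X N A₁ A₀ ∧ Covers I C X N ∧ IsCFactor X N) ∧
  (∃ F : LieSubalgebra k L, IsSupplement F I C ∧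
    Nonempty ((L ⧸ N) ≃ₗ⁅k⁆
      SemiDirectSum (factor I C) (F.map (quotHom C)) (subalgebraAction I C F))) ∧
  (IsPrimitiveTypeTwo k (L ⧸ C) ∧ socle k (L ⧸ C) = factor I C)

/-- The `c'`-factor `H₁/K₁` and the `c`-factor `H₂/K₂` are nonabelian and are both covered by a
`c'`-factor `B₁/B₀` that admits ideals `I, C, X, N` as above. -/
def IsMixedPair (H₁ K₁ H₂ K₂ : LieIdeal k L) : Prop :=
  IsNonabelianFactor H₁ K₁ ∧ IsNonabelianFactor H₂ K₂ ∧
  IsCPrimeFactor H₁ K₁ ∧ IsCFactor H₂ K₂ ∧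
  ∃ B₁ B₀ : LieIdeal k L, IsCPrimeFactor B₁ B₀ ∧ Covers B₁ B₀ H₁ K₁ ∧ Covers B₁ B₀ H₂ K₂ ∧
    ∃ I C X N : LieIdeal k L, IsCrossingData B₁ B₀ H₂ K₂ I C X N

end Factors

/-! ### The crown of an `L`-algebra and `cc'`-type -/

section Crown

variable {L : Type*} [LieRing L] [LieAlgebra k L]
variable {A : Type*} [LieRing A] [LieAlgebra k A]

/-- `E_L(A)_{A ⋊ L}`: the core of `E_L(A)` in `A ⋊ L`, viewed as an ideal of `L`. -/
def cocycleCore (θ : L →ₗ⁅k⁆ LieDerivation k A A) : LieIdeal k L :=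
  (core ((cocycleZeros θ).map (SemiDirectSum.inr θ))).comap (SemiDirectSum.inr θ)

/-- The ideals `R ⊆ I = I_L(A)` of `L` with `A ∼_L I/R` and `I/R` non-Frattini. -/
def crownKernels (θ : L →ₗ⁅k⁆ LieDerivation k A A) : Set (LieIdeal k L) :=
  {R | R ≤ innerIdeal θ ∧ LEquivalent θ (factorAction (innerIdeal θ) R) ∧
    ¬ IsFrattiniFactor (innerIdeal θ) R}

/-- `D_L(A)`: the intersection of the above ideals (`L` if there are none). -/
def crownBottom (θ : L →ₗ⁅k⁆ LieDerivation k A A) : LieIdeal k L := sInf (crownKernels θ)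

/-- `P = L/R` is a primitive epimorphic image of `L` corresponding to `A`. -/
def IsCorrespondingPrimitive (θ : L →ₗ⁅k⁆ LieDerivation k A A) (R : LieIdeal k L) : Prop :=
  R ∈ crownKernels θ ∧ IsPrimitive k (L ⧸ R)

/-- `A` is of `cc'`-type in `L`: there are two chief series of `L`, with a bijection between
their factors that pairs `m`-related factors, and a pair of corresponding `m'`-factors, the first
`L`-equivalent to `A`, one of which is a `c`-factor and the other a `c'`-factor as above. -/
def IsCCPrimeType (θ : L →ₗ⁅k⁆ LieDerivation k A A) : Prop :=
  ∃ (n : ℕ) (X Y : Fin (n + 1) → LieIdeal k L) (π : Equiv.Perm (Fin n)),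
    IsChiefSeries X ∧ IsChiefSeries Y ∧
    (∀ i, MRelated (X i.succ) (X i.castSucc) (Y (π i).succ) (Y (π i).castSucc)) ∧
    ∃ i : Fin n,
      IsMPrimeFactor (X i.succ) (X i.castSucc) ∧
      IsMPrimeFactor (Y (π i).succ) (Y (π i).castSucc) ∧
      (IsMixedPair (X i.succ) (X i.castSucc) (Y (π i).succ) (Y (π i).castSucc) ∨
        IsMixedPair (Y (π i).succ) (Y (π i).castSucc) (X i.succ) (X i.castSucc)) ∧
      LEquivalent θ (factorAction (X i.succ) (X i.castSucc))

end Crown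

end CCType

/-!
Let `I = I_L(A)` and let `C` be an ideal with `A ∼_L I/C`, so that `I/C` is a chief factor with
centralizer `C`. The 1-cocycles `L → I/C` are the differences `δ - q` of the quotient map
`q : L → L/C` and the homomorphisms `δ : L → L/C` congruent to `q` modulo `I/C` (the "twists" of
`q`). The kernels of the surjective twists are exactly the `R ⊆ I` with `A ∼_L I/R`, so `D_L(A)`
is the set of common zeros of the surjective twists, while `E_L(A)_{A ⋊ L}` is that of all twists.
If `I/C` is a `c'`-factor, a dimension count shows that no other twist vanishes on `D_L(A)`, so
`E_L(A)_{A ⋊ L} ⊂ D_L(A)` means that some twist `δ` is not surjective.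

In that case `X = ker δ` and `N = X ∩ C` satisfy `I/C ↘ X/N` and `L/N ≅ (I/C) ⋊ im δ`. The
equalizer of `δ` and `q` is a complement of `X/N`, and again by dimensions no complement is maximal.
The chief factors between `N` and `C` are `m`-related to their joins with `X`, which gives two
chief series, one through `N < C < I` and the other through `N < X < I`, that pair `I/C` with
`X/N`. Conversely, a complement `M` of `X/N` yields the twist `x + m ↦ m + C`, where `x ∈ X` and
`m ∈ M`, which is not surjective unless `M` is maximal.
-/

namespace CCType

open LieAlgebra

section LieHoms

variable {R M P Q : Type*} [CommRing R] [LieRing M] [LieAlgebra R M] [LieRing P] [LieAlgebra R P]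
  [LieRing Q] [LieAlgebra R Q]

lemma exists_lieHom_of_ker_le {f : M →ₗ⁅R⁆ P} {g : M →ₗ⁅R⁆ Q} (hf : Function.Surjective f)
    (hfg : f.ker ≤ g.ker) : ∃ h : P →ₗ⁅R⁆ Q, ∀ x, h (f x) = g x := by
  choose s hs using hf
  have comp (x : M) : g (s (f x)) = g x := by
    rw [← sub_eq_zero, ← map_sub, ← LieHom.mem_ker]
    exact hfg (LieHom.mem_ker.2 (by rw [map_sub, hs, sub_self]))
  exact ⟨{ toFun := fun p => g (s p)
           map_add' := fun p q => by rw [← map_add, ← comp (s p + s q), map_add f, hs, hs]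
           map_smul' := fun t p => by
            rw [RingHom.id_apply, ← map_smul, ← comp (t • s p), map_smul f, hs]
           map_lie' := fun {p q} => by
            rw [← LieHom.map_lie, ← comp ⁅s p, s q⁆, LieHom.map_lie f, hs, hs] }, comp⟩

lemma exists_lieEquiv_of_ker_eq {f : M →ₗ⁅R⁆ P} {g : M →ₗ⁅R⁆ Q} (hf : Function.Surjective f)
    (hg : Function.Surjective g) (hfg : f.ker = g.ker) :
    ∃ e : P ≃ₗ⁅R⁆ Q, ∀ x, e (f x) = g x := by
  obtain ⟨h, hh⟩ := exists_lieHom_of_ker_le hf hfg.le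
  have injective : Function.Injective h := by
    rw [injective_iff_map_eq_zero]
    intro p hp
    obtain ⟨x, rfl⟩ := hf p
    rwa [hh, ← LieHom.mem_ker, ← hfg, LieHom.mem_ker] at hp
  have surjective : Function.Surjective h := fun q =>
    let ⟨x, hx⟩ := hg q
    ⟨f x, by rw [hh, hx]⟩
  exact ⟨LieEquiv.ofBijective h ⟨injective, surjective⟩, hh⟩

/-- The subalgebras of `P` correspond to the subalgebras of `M` containing the kernel of a
surjection `f : M → P`. -/
def subalgebraComapEquiv (f : M →ₗ⁅R⁆ P) (hf : Function.Surjective f) :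
    LieSubalgebra R P ≃o Set.Ici f.ker.toLieSubalgebra where
  toFun V := ⟨V.comap f, fun x hx => by
    rw [LieSubalgebra.mem_comap, LieHom.mem_ker.1 hx]
    exact V.zero_mem⟩
  invFun U := U.1.map f
  left_inv V := SetLike.ext fun p => by
    obtain ⟨x, rfl⟩ := hf p
    exact ⟨fun ⟨_, hy, hyx⟩ => hyx ▸ hy, fun hx => ⟨x, hx, rfl⟩⟩
  right_inv U := Subtype.ext <| SetLike.ext fun x => by
    refine ⟨fun ⟨y, hy, hyx⟩ => ?_, fun hx => ⟨x, hx, rfl⟩⟩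
    have hxy : x - y ∈ U.1 := U.2 (LieHom.mem_ker.2 (by rw [map_sub, sub_eq_zero]; exact hyx.symm))
    simpa using U.1.add_mem hxy hy
  map_rel_iff' {V W} := by
    refine ⟨fun h p hp => ?_, fun h x hx => h hx⟩
    obtain ⟨x, rfl⟩ := hf p
    exact h (show x ∈ V.comap f from hp)

lemma toSubmodule_sup (J : LieIdeal R M) (U : LieSubalgebra R M) :
    (J.toLieSubalgebra ⊔ U).toSubmodule = J.toSubmodule ⊔ U.toSubmodule := by
  let S : LieSubalgebra R M :=
    { J.toSubmodule ⊔ U.toSubmodule with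
      lie_mem' := by
        intro x y hx hy
        obtain ⟨a, ha, u, hu, rfl⟩ := Submodule.mem_sup.1 hx
        obtain ⟨b, hb, v, hv, rfl⟩ := Submodule.mem_sup.1 hy
        refine Submodule.mem_sup.2 ⟨⁅a, b + v⁆ + ⁅u, b⁆, ?_, ⁅u, v⁆, U.lie_mem hu hv, ?_⟩
        · exact J.add_mem (lie_mem_left R M J a _ ha) (J.lie_mem hb)
        · simp only [add_lie, lie_add]
          abel }
  have le_S : J.toLieSubalgebra ⊔ U ≤ S :=
    sup_le (le_sup_left : J.toSubmodule ≤ _) (le_sup_right : U.toSubmodule ≤ _)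
  exact le_antisymm le_S (sup_le (le_sup_left : J.toLieSubalgebra ≤ J.toLieSubalgebra ⊔ U)
    (le_sup_right : U ≤ J.toLieSubalgebra ⊔ U))

lemma sup_eq_top_of_isCoatom {J : LieIdeal R M} {U : LieSubalgebra R M} (hU : IsCoatom U)
    (h : ¬ J.toSubmodule ≤ U.toSubmodule) : J.toSubmodule ⊔ U.toSubmodule = ⊤ := by
  rw [← toSubmodule_sup, LieSubalgebra.toSubmodule_eq_top]
  exact hU.2 _ (right_lt_sup.2 h)

end LieHoms

variable {k : Type*} [Field k]

section Factors

variable {L : Type*} [LieRing L] [LieAlgebra k L] {H K : LieIdeal k L}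

lemma quotHom_surjective (K : LieIdeal k L) : Function.Surjective (quotHom K) :=
  Submodule.mkQ_surjective K.toSubmodule

lemma quotHom_eq_zero {x : L} : quotHom K x = 0 ↔ x ∈ K :=
  Submodule.Quotient.mk_eq_zero K.toSubmodule

lemma quotHom_eq_quotHom {x y : L} : quotHom K x = quotHom K y ↔ x - y ∈ K := by
  rw [← sub_eq_zero, ← map_sub, quotHom_eq_zero]

lemma ker_quotHom (K : LieIdeal k L) : (quotHom K).ker = K :=
  LieSubmodule.ext _ _ fun _ => LieHom.mem_ker.trans quotHom_eq_zero

lemma quotHom_mem_factor (h : K ≤ H) {x : L} : quotHom K x ∈ factor H K ↔ x ∈ H := by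
  refine ⟨fun ⟨y, hy, hyx⟩ => ?_, fun hx => ⟨x, hx, rfl⟩⟩
  simpa using H.add_mem (h (quotHom_eq_quotHom.1 hyx.symm)) hy

lemma comap_quotHom_factor (h : K ≤ H) : (factor H K).comap (quotHom K) = H :=
  LieSubmodule.ext _ _ fun _ => LieIdeal.mem_comap.trans (quotHom_mem_factor h)

/-- The ideals of `L` containing `K` correspond to the ideals of `L/K`. -/
def factorEquiv (K : LieIdeal k L) : Set.Ici K ≃o LieIdeal k (L ⧸ K) where
  toFun H := factor H K
  invFun J := ⟨J.comap (quotHom K), (ker_quotHom K).ge.trans (LieHom.ker_le_comap _ J)⟩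
  left_inv H := Subtype.ext (comap_quotHom_factor H.2)
  right_inv J := LieSubmodule.ext _ _ fun y => by
    obtain ⟨x, rfl⟩ := quotHom_surjective K y
    exact quotHom_mem_factor ((ker_quotHom K).ge.trans (LieHom.ker_le_comap _ J))
  map_rel_iff' {H H'} :=
    ⟨fun h x hx => (quotHom_mem_factor H'.2).1 (h ⟨x, hx, rfl⟩),
      fun h _ ⟨x, hx, hxy⟩ => ⟨x, h hx, hxy⟩⟩

lemma isChiefFactor_iff_covBy : IsChiefFactor H K ↔ K ⋖ H := by
  have atom_iff (h : K ≤ H) : IsAtom (factor H K) ↔ K ⋖ H :=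
    ((factorEquiv K).isAtom_iff ⟨H, h⟩).trans Set.Ici.isAtom_iff
  exact ⟨fun h => (atom_iff h.1).1 h.2, fun h => ⟨h.le, (atom_iff h.le).2 h⟩⟩

lemma isLieAbelian_factor_iff : IsLieAbelian (factor H K) ↔ ∀ x ∈ H, ∀ y ∈ H, ⁅x, y⁆ ∈ K := by
  refine ⟨fun h x hx y hy => ?_, fun h => ⟨?_⟩⟩
  · have hxy := h.trivial ⟨quotHom K x, x, hx, rfl⟩ ⟨quotHom K y, y, hy, rfl⟩
    exact quotHom_eq_zero.1 (congrArg Subtype.val hxy)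
  · rintro ⟨_, x, hx, rfl⟩ ⟨_, y, hy, rfl⟩
    exact Subtype.ext (quotHom_eq_zero.2 (h x hx y hy))

lemma core_le (U : LieSubalgebra k L) : (core U).toSubmodule ≤ U.toSubmodule := by
  rw [core, LieSubmodule.sSup_toSubmodule_eq_iSup]
  exact iSup₂_le fun J hJ => hJ

lemma le_core {U : LieSubalgebra k L} {J : LieIdeal k L} :
    J ≤ core U ↔ J.toSubmodule ≤ U.toSubmodule :=
  ⟨fun h => le_trans (b := (core U).toSubmodule) h (core_le U), fun h => le_sSup h⟩

lemma le_frattiniIdeal {J : LieIdeal k L} :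
    J ≤ frattiniIdeal k L ↔
      ∀ U : LieSubalgebra k L, IsCoatom U → J.toSubmodule ≤ U.toSubmodule := by
  rw [frattiniIdeal, le_core]
  exact le_sInf_iff (a := J.toLieSubalgebra)

lemma isFrattiniFactor_iff :
    IsFrattiniFactor H K ↔ ∀ U : LieSubalgebra k L, IsCoatom U →
      K.toSubmodule ≤ U.toSubmodule → H.toSubmodule ≤ U.toSubmodule := by
  let e := subalgebraComapEquiv (quotHom K) (quotHom_surjective K)
  have le_ker (U : LieSubalgebra k L) :
      (quotHom K).ker.toLieSubalgebra ≤ U ↔ K.toSubmodule ≤ U.toSubmodule := by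
    rw [ker_quotHom]; rfl
  rw [IsFrattiniFactor, le_frattiniIdeal]
  constructor
  · intro h U hU hK x hx
    have map_isCoatom : IsCoatom (e.symm ⟨U, (le_ker U).2 hK⟩) :=
      (e.symm.isCoatom_iff _).2 (hU.Ici ((le_ker U).2 hK))
    have : (e (e.symm ⟨U, (le_ker U).2 hK⟩)).1 = U := by rw [e.apply_symm_apply]
    rw [← this]
    exact h _ map_isCoatom ⟨x, hx, rfl⟩
  · rintro h V hV _ ⟨x, hx, rfl⟩
    exact h (e V).1 ((e.isCoatom_iff V).2 hV).of_isCoatom_coe_Ici ((le_ker _).1 (e V).2) hx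

end Factors

section Frattini

variable {L : Type*} [LieRing L] [LieAlgebra k L]

lemma isLieAbelian_of_isAtom_of_isSolvable {J : LieIdeal k L} (hJ : IsAtom J)
    [IsSolvable J] : IsLieAbelian J := by
  rw [LieSubmodule.lie_abelian_iff_lie_self_eq_bot]
  refine (hJ.le_iff.1 (LieSubmodule.lie_le_right J J)).resolve_right fun perfect => hJ.1 ?_
  obtain ⟨n, hn⟩ := (isSolvable_iff k J).1 ‹_›
  rw [LieIdeal.derivedSeries_eq_bot_iff] at hn
  rw [← hn]
  clear hn
  induction n with
  | zero => rfl
  | succ n ih => rw [derivedSeriesOfIdeal_succ, ← ih, perfect]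

lemma IsChiefFactor.isSupplementedChiefFactor {H K : LieIdeal k L} (hc : IsChiefFactor H K)
    (hF : ¬ IsFrattiniFactor H K) : IsSupplementedChiefFactor H K := by
  rw [isFrattiniFactor_iff] at hF
  push Not at hF
  obtain ⟨U, hU, hKU, hHU⟩ := hF
  exact ⟨hc, U, hU.1, sup_eq_top_of_isCoatom hU hHU, le_inf hc.1 hKU⟩

variable [FiniteDimensional k L]

lemma engel_eq_top_of_mem_frattiniIdeal {x : L} (hx : x ∈ frattiniIdeal k L) :
    LieSubalgebra.engel k x = ⊤ := by
  refine (eq_top_or_exists_le_coatom _).resolve_right fun ⟨U, hU, engel_le⟩ => hU.1 ?_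
  -- Fitting: `L` is the sum of the Engel subalgebra of `x` and an iterated image of `ad x`, and
  -- both summands lie in `U`.
  obtain ⟨n, hn⟩ := Filter.eventually_atTop.1
    (LinearMap.eventually_codisjoint_ker_pow_range_pow (ad k L x))
  rw [← LieSubalgebra.toSubmodule_eq_top, eq_top_iff, ← (hn (n + 1) (by lia)).eq_top]
  refine sup_le (fun y hy => engel_le ?_) ?_
  · exact (LieSubalgebra.mem_engel_iff k x y).2 ⟨n + 1, hy⟩
  · rintro _ ⟨y, rfl⟩
    rw [pow_succ']
    exact le_frattiniIdeal.1 le_rfl U hU (lie_mem_left k L _ x _ hx)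

lemma isNilpotent_of_le_frattiniIdeal {J : LieIdeal k L} (hJ : J ≤ frattiniIdeal k L) :
    LieRing.IsNilpotent J :=
  LieSubalgebra.isNilpotent_of_forall_le_engel (R := k) J.toLieSubalgebra fun x hx => by
    rw [engel_eq_top_of_mem_frattiniIdeal (hJ hx)]
    exact le_top

lemma not_isFrattiniFactor {H K : LieIdeal k L} (hc : IsChiefFactor H K)
    (hn : IsNonabelianFactor H K) : ¬ IsFrattiniFactor H K := fun h =>
  have := isNilpotent_of_le_frattiniIdeal h
  hn (isLieAbelian_of_isAtom_of_isSolvable hc.2)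

end Frattini

section Equivalence

variable {L : Type*} [LieRing L] [LieAlgebra k L]
variable {A : Type*} [LieRing A] [LieAlgebra k A] {θ : L →ₗ⁅k⁆ LieDerivation k A A}
variable {B : Type*} [LieRing B] [LieAlgebra k B] {ψ : L →ₗ⁅k⁆ LieDerivation k B B}
variable {B' : Type*} [LieRing B'] [LieAlgebra k B'] {χ : L →ₗ⁅k⁆ LieDerivation k B' B'}

lemma LEquivalent.exists_lieEquiv (h : LEquivalent θ ψ) :
    ∃ (Φ : SemiDirectSum A L θ ≃ₗ⁅k⁆ SemiDirectSum B L ψ) (φ : A ≃ₗ⁅k⁆ B),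
      (∀ a, Φ (SemiDirectSum.inl θ a) = SemiDirectSum.inl ψ (φ a)) ∧
      ∀ y, (Φ y).right = y.right := by
  obtain ⟨Φ, φ, hφ, hΦ⟩ := h
  have injective : Function.Injective φ := fun a b hab =>
    SemiDirectSum.inl_injective θ <| Φ.injective <|
      ((hφ a).trans (congrArg _ hab)).trans (hφ b).symm
  have surjective : Function.Surjective φ := fun b => by
    obtain ⟨⟨a, x⟩, hax⟩ : ∃ y, Φ y = SemiDirectSum.inl ψ b := Φ.surjective _
    obtain rfl : 0 = x := (congrArg SemiDirectSum.right hax).symm.trans (hΦ ⟨a, x⟩)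
    exact ⟨a, SemiDirectSum.inl_injective ψ ((hφ a).symm.trans hax)⟩
  exact ⟨Φ, LieEquiv.ofBijective φ ⟨injective, surjective⟩, hφ, hΦ⟩

lemma LEquivalent.symm (h : LEquivalent θ ψ) : LEquivalent ψ θ := by
  obtain ⟨Φ, φ, hφ, hΦ⟩ := h.exists_lieEquiv
  refine ⟨Φ.symm, φ.symm, fun b => ?_, fun y => ?_⟩
  · apply Φ.injective
    change Φ (Φ.symm _) = Φ (SemiDirectSum.inl θ (φ.symm b))
    rw [hφ, LieEquiv.apply_symm_apply, LieEquiv.apply_symm_apply]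
  · exact (hΦ (Φ.symm y)).symm.trans (congrArg _ (LieEquiv.apply_symm_apply Φ y))

lemma LEquivalent.trans (h : LEquivalent θ ψ) (h' : LEquivalent ψ χ) : LEquivalent θ χ := by
  obtain ⟨Φ, φ, hφ, hΦ⟩ := h
  obtain ⟨Φ', φ', hφ', hΦ'⟩ := h'
  exact ⟨Φ.trans Φ', φ'.comp φ, fun a => (congrArg Φ' (hφ a)).trans (hφ' (φ a)),
    fun y => (hΦ' (Φ y)).trans (hΦ y)⟩

lemma LEquivalent.exists_isOneCocycle (h : LEquivalent θ ψ) :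
    ∃ (φ : A ≃ₗ⁅k⁆ B) (β : L →ₗ[k] B), IsOneCocycle ψ β ∧
      ∀ x a, φ (θ x a) = ψ x (φ a) + ⁅β x, φ a⁆ := by
  obtain ⟨Φ, φ, hφ, hΦ⟩ := h.exists_lieEquiv
  let β : L →ₗ[k] B :=
    SemiDirectSum.projl ψ ∘ₗ Φ.toLinearEquiv ∘ₗ (SemiDirectSum.inr θ).toLinearMap
  have apply_inr (x : L) : Φ (SemiDirectSum.inr θ x) = ⟨β x, x⟩ := SemiDirectSum.ext rfl (hΦ _)
  refine ⟨φ, β, fun x y => ?_, fun x a => ?_⟩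
  · have := congrArg SemiDirectSum.left (apply_inr ⁅x, y⁆)
    rw [LieHom.map_lie, LieEquiv.map_lie, apply_inr, apply_inr] at this
    simp only [SemiDirectSum.lie_eq_mk] at this
    rw [← this]
    abel
  · have inl_action : SemiDirectSum.inl θ (θ x a) =
        ⁅SemiDirectSum.inr θ x, SemiDirectSum.inl θ a⁆ := by simp
    have map_action := congrArg Φ inl_action
    rw [LieEquiv.map_lie, hφ, hφ, apply_inr] at map_action
    simpa [add_comm] using congrArg SemiDirectSum.left map_action

lemma LEquivalent.of_isOneCocycle {φ : A ≃ₗ⁅k⁆ B} {β : L →ₗ[k] B} (hβ : IsOneCocycle ψ β)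
    (hφ : ∀ x a, φ (θ x a) = ψ x (φ a) + ⁅β x, φ a⁆) : LEquivalent θ ψ := by
  let Φ : SemiDirectSum A L θ →ₗ⁅k⁆ SemiDirectSum B L ψ :=
    { toFun := fun y => ⟨φ y.left + β y.right, y.right⟩
      map_add' := fun y z => SemiDirectSum.ext
        (by simp only [SemiDirectSum.add_eq_mk, map_add]; abel) rfl
      map_smul' := fun t y => SemiDirectSum.ext
        (by simp only [SemiDirectSum.smul_eq_mk, map_smul, smul_add, RingHom.id_apply]) rfl
      map_lie' := fun {y z} => SemiDirectSum.ext (by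
        simp only [SemiDirectSum.lie_eq_mk, map_add, map_sub, LieEquiv.map_lie, hφ, hβ _ _,
          lie_add, add_lie]
        rw [← lie_skew (φ y.left) (β z.right)]
        abel) rfl }
  have injective : Function.Injective Φ := fun y z hyz => by
    have right : y.right = z.right := congrArg (fun w : SemiDirectSum B L ψ => w.right) hyz
    have left : φ y.left + β y.right = φ z.left + β z.right :=
      congrArg (fun w : SemiDirectSum B L ψ => w.left) hyz
    rw [right, add_left_inj] at left
    exact SemiDirectSum.ext (φ.injective left) right
  have surjective : Function.Surjective Φ := fun y =>
    ⟨⟨φ.symm (y.left - β y.right), y.right⟩, SemiDirectSum.ext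
      (by change φ (φ.symm _) + _ = _; rw [LieEquiv.apply_symm_apply, sub_add_cancel]) rfl⟩
  refine ⟨LieEquiv.ofBijective Φ ⟨injective, surjective⟩, φ, fun a => ?_, fun _ => rfl⟩
  exact SemiDirectSum.ext (by change φ a + β 0 = φ a; rw [map_zero, add_zero]) rfl

lemma LEquivalent.isLieAbelian_iff (h : LEquivalent θ ψ) : IsLieAbelian A ↔ IsLieAbelian B :=
  let ⟨φ, _⟩ := h.exists_isOneCocycle
  lie_abelian_iff_equiv_lie_abelian φ

lemma LEquivalent.innerIdeal_le (h : LEquivalent θ ψ) : innerIdeal θ ≤ innerIdeal ψ := by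
  obtain ⟨φ, β, -, hφ⟩ := h.exists_isOneCocycle
  rintro x ⟨a, ha⟩
  refine ⟨φ a - β x, fun b => ?_⟩
  obtain ⟨b, rfl⟩ : ∃ c, φ c = b := φ.surjective b
  rw [sub_lie, ← LieEquiv.map_lie, ← ha, hφ, add_sub_cancel_right]

lemma LEquivalent.innerIdeal_eq (h : LEquivalent θ ψ) : innerIdeal θ = innerIdeal ψ :=
  le_antisymm h.innerIdeal_le h.symm.innerIdeal_le

lemma mem_centralizer {x : L} : x ∈ centralizer θ ↔ ∀ a, θ x a = 0 :=
  LieHom.mem_ker.trans ⟨fun h a => by rw [h, LieDerivation.zero_apply],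
    fun h => LieDerivation.ext h⟩

lemma mem_cocycleCore {x : L} :
    x ∈ cocycleCore θ ↔ x ∈ centralizer θ ∧ x ∈ cocycleZeros θ := by
  let J : LieIdeal k (SemiDirectSum A L θ) :=
    { LinearMap.ker (SemiDirectSum.projl θ) ⊓ ((centralizer θ).toSubmodule ⊓
        (cocycleZeros θ).toSubmodule).comap (SemiDirectSum.projr θ).toLinearMap with
      lie_mem := by
        rintro y ⟨_, z⟩ ⟨rfl, hz, hz'⟩
        have action_zero : ∀ a, θ z a = 0 := mem_centralizer.1 hz
        refine ⟨?_, (centralizer θ).lie_mem hz, fun α hα => ?_⟩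
        · simp [action_zero]
        · have zero : α z = 0 := hz' α hα
          change α ⁅y.right, z⁆ = 0
          rw [hα y.right z, zero, map_zero, action_zero, lie_zero, sub_zero, add_zero] }
  rw [cocycleCore, LieIdeal.mem_comap]
  constructor
  · intro hx
    obtain ⟨y, hy, hyx⟩ := core_le _ hx
    obtain rfl : y = x := congrArg SemiDirectSum.right hyx
    refine ⟨mem_centralizer.2 fun a => ?_, hy⟩
    obtain ⟨z, -, hz⟩ := core_le _ (LieSubmodule.lie_mem _ (x := SemiDirectSum.inl θ a) hx)
    simpa using congrArg SemiDirectSum.left hz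
  · rintro ⟨hx, hx'⟩
    have : J ≤ core ((cocycleZeros θ).map (SemiDirectSum.inr θ)) :=
      le_core.2 fun ⟨_, y⟩ ⟨ha, _, hy⟩ => ⟨y, hy, SemiDirectSum.ext ha.symm rfl⟩
    exact this ⟨rfl, hx, hx'⟩

lemma IsOneCocycle.comp_add {φ : A ≃ₗ⁅k⁆ B} {α : L →ₗ[k] A} {β : L →ₗ[k] B}
    (hα : IsOneCocycle θ α) (hβ : IsOneCocycle ψ β)
    (hφ : ∀ x a, φ (θ x a) = ψ x (φ a) + ⁅β x, φ a⁆) :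
    IsOneCocycle ψ (φ.toLinearEquiv ∘ₗ α + β) := by
  intro x y
  change φ (α ⁅x, y⁆) + β ⁅x, y⁆ = ψ x (φ (α y) + β y) - ψ y (φ (α x) + β x) +
    ⁅φ (α x) + β x, φ (α y) + β y⁆
  rw [hα x y, hβ x y]
  simp only [map_add, map_sub, LieEquiv.map_lie, hφ, add_lie, lie_add]
  rw [← lie_skew (φ (α x)) (β y)]
  abel

lemma LEquivalent.cocycleCore_le (h : LEquivalent θ ψ) : cocycleCore ψ ≤ cocycleCore θ := by
  obtain ⟨φ, β, hβ, hφ⟩ := h.exists_isOneCocycle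
  intro x hx
  obtain ⟨hx, hx'⟩ := mem_cocycleCore.1 hx
  refine mem_cocycleCore.2 ⟨mem_centralizer.2 fun a => φ.injective ?_, fun α hα => φ.injective ?_⟩
  · change φ (θ x a) = φ 0
    rw [hφ, mem_centralizer.1 hx, hx' β hβ, zero_lie, add_zero, map_zero]
  · have : φ (α x) + β x = 0 := hx' _ (hα.comp_add hβ hφ)
    rw [hx' β hβ, add_zero] at this
    exact this.trans (map_zero φ).symm

lemma LEquivalent.cocycleCore_eq (h : LEquivalent θ ψ) : cocycleCore θ = cocycleCore ψ :=
  le_antisymm h.symm.cocycleCore_le h.cocycleCore_le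

end Equivalence

section ChiefFactors

variable {L : Type*} [LieRing L] [LieAlgebra k L]

lemma exists_factor_lieEquiv {M : Type*} [LieRing M] [LieAlgebra k M] {H K : LieIdeal k L}
    {J : LieIdeal k M} {f : L →ₗ⁅k⁆ M} (hf : ∀ x ∈ H, f x ∈ J) (surj : ∀ y ∈ J, ∃ x ∈ H, f x = y)
    (ker : ∀ x ∈ H, f x = 0 ↔ x ∈ K) :
    ∃ e : factor H K ≃ₗ⁅k⁆ J, ∀ x (hx : x ∈ H), e ⟨quotHom K x, x, hx, rfl⟩ = f x := by
  let toFactor : H →ₗ⁅k⁆ factor H K :=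
    { toFun := fun x => ⟨quotHom K x, x, x.2, rfl⟩
      map_add' := fun _ _ => rfl
      map_smul' := fun _ _ => rfl
      map_lie' := rfl }
  let toIdeal : H →ₗ⁅k⁆ J :=
    { f.toLinearMap.restrict hf with
      map_lie' := fun {x y} => Subtype.ext (f.map_lie x y) }
  have toFactor_surjective : Function.Surjective toFactor := fun ⟨_, x, hx, hxy⟩ =>
    ⟨⟨x, hx⟩, Subtype.ext hxy⟩
  have toIdeal_surjective : Function.Surjective toIdeal := fun ⟨y, hy⟩ =>
    let ⟨x, hx, hxy⟩ := surj y hy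
    ⟨⟨x, hx⟩, Subtype.ext hxy⟩
  have ker_eq : toFactor.ker = toIdeal.ker := LieSubmodule.ext _ _ fun x => by
    rw [LieHom.mem_ker, LieHom.mem_ker, ← Subtype.val_inj, ← Subtype.val_inj]
    exact quotHom_eq_zero.trans (ker x x.2).symm
  obtain ⟨e, he⟩ := exists_lieEquiv_of_ker_eq toFactor_surjective toIdeal_surjective ker_eq
  exact ⟨e, fun x hx => congrArg Subtype.val (he ⟨x, hx⟩)⟩

variable {H K : LieIdeal k L}

lemma mem_centralizer_factorAction {x : L} :
    x ∈ centralizer (factorAction H K) ↔ ∀ y ∈ H, ⁅x, y⁆ ∈ K := by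
  rw [mem_centralizer]
  constructor
  · exact fun h y hy => quotHom_eq_zero.1 (congrArg Subtype.val (h ⟨_, y, hy, rfl⟩))
  · rintro h ⟨_, y, hy, rfl⟩
    exact Subtype.ext (quotHom_eq_zero.2 (h y hy))

lemma innerIdeal_factorAction (H K : LieIdeal k L) :
    innerIdeal (factorAction H K) = centralizer (factorAction H K) ⊔ H := by
  ext x
  rw [LieSubmodule.mem_sup]
  constructor
  · rintro ⟨⟨_, y, hy, rfl⟩, hxy⟩
    refine ⟨x - y, mem_centralizer_factorAction.2 fun z hz => ?_, y, hy, sub_add_cancel x y⟩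
    rw [sub_lie, ← quotHom_eq_quotHom]
    exact congrArg Subtype.val (hxy ⟨_, z, hz, rfl⟩)
  · rintro ⟨z, hz, y, hy, rfl⟩
    refine ⟨⟨quotHom K y, y, hy, rfl⟩, fun b => ?_⟩
    rw [map_add, LieDerivation.add_apply, mem_centralizer.1 hz, zero_add]
    rfl

lemma IsNonabelianFactor.centralizer_inf (hn : IsNonabelianFactor H K) (hc : K ⋖ H) :
    centralizer (factorAction H K) ⊓ H = K := by
  have le : K ≤ centralizer (factorAction H K) := fun x hx =>
    mem_centralizer_factorAction.2 fun y _ => lie_mem_left k L K x y hx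
  refine (hc.eq_or_eq (le_inf le hc.le) inf_le_right).resolve_right fun H_eq => hn ?_
  refine isLieAbelian_factor_iff.2 fun x hx => ?_
  exact mem_centralizer_factorAction.1 (inf_eq_right.1 H_eq hx)

lemma IsNonabelianFactor.sup_lie (hn : IsNonabelianFactor H K) (hc : K ⋖ H) : K ⊔ ⁅H, H⁆ = H := by
  refine (hc.eq_or_eq le_sup_left (sup_le hc.le (LieSubmodule.lie_le_left H H))).resolve_left ?_
  refine fun K_eq => hn (isLieAbelian_factor_iff.2 fun x hx y hy => ?_)
  exact sup_eq_left.1 K_eq (LieSubmodule.lie_mem_lie hx hy)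

variable {A B C D : LieIdeal k L}

lemma Covers.lEquivalent (h : Covers A B C D) :
    LEquivalent (factorAction C D) (factorAction A B) := by
  obtain ⟨rfl, rfl⟩ := h
  obtain ⟨e, he⟩ : ∃ e : factor C (B ⊓ C) ≃ₗ⁅k⁆ factor (B ⊔ C) B,
      ∀ x (hx : x ∈ C), e ⟨quotHom (B ⊓ C) x, x, hx, rfl⟩ = quotHom B x := by
    refine exists_factor_lieEquiv (fun x hx => ⟨x, le_sup_right (a := B) hx, rfl⟩) ?_ fun x hx => ?_
    · rintro _ ⟨x, hx, rfl⟩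
      obtain ⟨b, hb, c, hc, rfl⟩ := (LieSubmodule.mem_sup _ _ _).1 hx
      exact ⟨c, hc, quotHom_eq_quotHom.2 (by simpa using hb)⟩
    · rw [quotHom_eq_zero]
      exact ⟨fun hB => ⟨hB, hx⟩, And.left⟩
  refine LEquivalent.of_isOneCocycle (φ := e) (β := 0) (fun x y => by simp) ?_
  rintro x ⟨_, y, hy, rfl⟩
  refine Subtype.ext ?_
  rw [LinearMap.zero_apply, zero_lie, add_zero]
  exact (he ⁅x, y⁆ (C.lie_mem hy)).trans
    (((quotHom B).map_lie x y).trans (congrArg (⁅quotHom B x, ·⁆) (he y hy).symm))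

lemma Covers.covBy_iff (h : Covers A B C D) : B ⋖ A ↔ D ⋖ C := by
  obtain ⟨rfl, rfl⟩ := h
  exact ⟨fun h => inf_covBy_of_covBy_sup_left h, fun h => covBy_sup_of_inf_covBy_right h⟩

lemma Covers.isNonabelianFactor_iff (h : Covers A B C D) :
    IsNonabelianFactor A B ↔ IsNonabelianFactor C D :=
  not_congr h.lEquivalent.isLieAbelian_iff.symm

lemma Covers.centralizer_eq (h : Covers A B C D) :
    centralizer (factorAction A B) = centralizer (factorAction C D) := by
  obtain ⟨rfl, rfl⟩ := h
  ext x
  simp only [mem_centralizer_factorAction]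
  refine ⟨fun hx y hy => ⟨hx y (le_sup_right (a := B) hy), C.lie_mem hy⟩, fun hx y hy => ?_⟩
  obtain ⟨b, hb, c, hc, rfl⟩ := (LieSubmodule.mem_sup _ _ _).1 hy
  rw [lie_add]
  exact B.add_mem (B.lie_mem hb) (hx c hc).1

end ChiefFactors

section SelfCentralizing

variable {L : Type*} [LieRing L] [LieAlgebra k L]

/-- A chief factor `I/C` with `C_L(I/C) = C`; equivalently, `I/C` is nonabelian and is the only
minimal ideal of `L/C`. -/
structure IsSelfCentralizingFactor (I C : LieIdeal k L) : Prop where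
  covBy : C ⋖ I
  centralizer_eq : centralizer (factorAction I C) = C

variable {I C H K : LieIdeal k L}

namespace IsSelfCentralizingFactor

lemma isChiefFactor (h : IsSelfCentralizingFactor I C) : IsChiefFactor I C :=
  isChiefFactor_iff_covBy.2 h.covBy

lemma isNonabelianFactor (h : IsSelfCentralizingFactor I C) : IsNonabelianFactor I C := fun ab =>
  h.covBy.lt.not_ge fun _ hx => h.centralizer_eq.le <|
    mem_centralizer_factorAction.2 (isLieAbelian_factor_iff.1 ab _ hx)

lemma innerIdeal_eq (h : IsSelfCentralizingFactor I C) : innerIdeal (factorAction I C) = I := by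
  rw [innerIdeal_factorAction, h.centralizer_eq, sup_eq_right.2 h.covBy.le]

lemma eq_zero_of_lie_eq_zero (h : IsSelfCentralizingFactor I C) {y : L ⧸ C}
    (hy : ∀ s ∈ factor I C, ⁅y, s⁆ = 0) : y = 0 := by
  obtain ⟨x, rfl⟩ := quotHom_surjective C y
  refine quotHom_eq_zero.2 (h.centralizer_eq.le (mem_centralizer_factorAction.2 fun z hz => ?_))
  exact quotHom_eq_zero.1 (hy _ ⟨z, hz, rfl⟩)

lemma factor_le (h : IsSelfCentralizingFactor I C) {J : LieIdeal k (L ⧸ C)} (hJ : J ≠ ⊥) :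
    factor I C ≤ J := by
  refine (h.isChiefFactor.2.not_disjoint_iff_le).1 fun disjoint => hJ ?_
  refine (LieSubmodule.eq_bot_iff _).2 fun y hy => h.eq_zero_of_lie_eq_zero fun s hs => ?_
  exact (LieSubmodule.mem_bot _).1 <| disjoint.le_bot
    ⟨(factor I C).lie_mem hs, lie_mem_left k _ J y s hy⟩

lemma isAtom_iff (h : IsSelfCentralizingFactor I C) {J : LieIdeal k (L ⧸ C)} :
    IsAtom J ↔ J = factor I C :=
  ⟨fun hJ => ((hJ.le_iff_eq h.isChiefFactor.2.1).1 (h.factor_le hJ.1)).symm,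
    fun hJ => hJ ▸ h.isChiefFactor.2⟩

lemma socle_eq (h : IsSelfCentralizingFactor I C) : socle k (L ⧸ C) = factor I C := by
  simp only [socle, h.isAtom_iff, Set.ofPred_eq_eq_singleton, sSup_singleton]

lemma isPrimitive [FiniteDimensional k L] (h : IsSelfCentralizingFactor I C) :
    IsPrimitive k (L ⧸ C) := by
  have not_frattini := not_isFrattiniFactor h.isChiefFactor h.isNonabelianFactor
  rw [IsFrattiniFactor, le_frattiniIdeal] at not_frattini
  push Not at not_frattini
  obtain ⟨U, hU, not_le⟩ := not_frattini
  refine ⟨U, hU, by_contra fun core_ne => not_le ?_⟩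
  exact le_trans (b := (core U).toSubmodule) (h.factor_le core_ne) (core_le U)

lemma isPrimitiveTypeTwo [FiniteDimensional k L] (h : IsSelfCentralizingFactor I C) :
    IsPrimitiveTypeTwo k (L ⧸ C) :=
  ⟨h.isPrimitive, factor I C, h.isAtom_iff.2 rfl, fun _ => h.isAtom_iff.1, h.isNonabelianFactor⟩

end IsSelfCentralizingFactor

lemma IsNonabelianFactor.covers (hn : IsNonabelianFactor H K) (hc : K ⋖ H) :
    Covers (innerIdeal (factorAction H K)) (centralizer (factorAction H K)) H K :=
  ⟨innerIdeal_factorAction H K, hn.centralizer_inf hc⟩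

lemma IsNonabelianFactor.isSelfCentralizingFactor (hn : IsNonabelianFactor H K) (hc : K ⋖ H) :
    IsSelfCentralizingFactor (innerIdeal (factorAction H K)) (centralizer (factorAction H K)) :=
  ⟨(hn.covers hc).covBy_iff.2 hc, (hn.covers hc).centralizer_eq⟩

variable {A : Type*} [LieRing A] [LieAlgebra k A] {θ : L →ₗ⁅k⁆ LieDerivation k A A}

lemma LEquivalent.isAtom_factor (he : LEquivalent θ (factorAction H K))
    (hirr : IsIrreducibleLAlgebra θ) : IsAtom (factor H K) := by
  obtain ⟨φ, β, -, hφ⟩ := he.exists_isOneCocycle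
  have := hirr.1
  have : Nontrivial (factor H K) := φ.injective.nontrivial
  refine ⟨(LieSubmodule.nontrivial_iff_ne_bot _ _ _).1 this, fun J hJ => ?_⟩
  have surjective (y : L ⧸ K) (hy : y ∈ factor H K) : ∃ a, (φ a : L ⧸ K) = y :=
    (φ.surjective ⟨y, hy⟩).imp fun _ => congrArg Subtype.val
  let W : Submodule k A := (J.toSubmodule.comap (factor H K).toSubmodule.subtype).comap
    φ.toLinearEquiv.toLinearMap
  have stable (x : L) (a : A) (ha : (φ a : L ⧸ K) ∈ J) : (φ (θ x a) : L ⧸ K) ∈ J := by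
    rw [hφ]
    exact J.add_mem (J.lie_mem ha) (J.lie_mem (x := (β x : L ⧸ K)) ha)
  rcases hirr.2 W stable with W_eq | W_eq
  · refine (LieSubmodule.eq_bot_iff _).2 fun y hy => ?_
    obtain ⟨a, rfl⟩ := surjective y (hJ.le hy)
    have a_mem : a ∈ W := hy
    rw [W_eq, Submodule.mem_bot] at a_mem
    rw [a_mem, map_zero]
    rfl
  · refine absurd (fun y hy => ?_) hJ.not_ge
    obtain ⟨a, rfl⟩ := surjective y hy
    exact W_eq.ge Submodule.mem_top

lemma LEquivalent.isSelfCentralizingFactor (he : LEquivalent θ (factorAction (innerIdeal θ) C))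
    (hirr : IsIrreducibleLAlgebra θ) (hA : ¬ IsLieAbelian A) (hC : C ≤ innerIdeal θ) :
    IsSelfCentralizingFactor (innerIdeal θ) C := by
  have covBy := isChiefFactor_iff_covBy.1 ⟨hC, he.isAtom_factor hirr⟩
  refine ⟨covBy, ?_⟩
  have centralizer_le : centralizer (factorAction (innerIdeal θ) C) ≤ innerIdeal θ :=
    (le_sup_left.trans (innerIdeal_factorAction _ C).ge).trans he.innerIdeal_eq.ge
  rw [← inf_eq_left.2 centralizer_le]
  exact IsNonabelianFactor.centralizer_inf (fun ab => hA (he.isLieAbelian_iff.2 ab)) covBy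

lemma mem_crownKernels_iff [FiniteDimensional k L] (hirr : IsIrreducibleLAlgebra θ)
    (hA : ¬ IsLieAbelian A) :
    C ∈ crownKernels θ ↔ C ≤ innerIdeal θ ∧ LEquivalent θ (factorAction (innerIdeal θ) C) := by
  refine ⟨fun h => ⟨h.1, h.2.1⟩, fun ⟨hC, he⟩ => ⟨hC, he, ?_⟩⟩
  have h := he.isSelfCentralizingFactor hirr hA hC
  exact not_isFrattiniFactor h.isChiefFactor h.isNonabelianFactor

end SelfCentralizing

section Complements

variable {L M : Type*} [LieRing L] [LieAlgebra k L] [LieRing M] [LieAlgebra k M]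

lemma exists_isComplement_comap_iff {f : L →ₗ⁅k⁆ M} (hf : Function.Surjective f)
    {J : LieIdeal k M} :
    (∃ U, IsComplement U (J.comap f) f.ker) ↔ ∃ V, IsComplement V J ⊥ := by
  let g : L →ₗ[k] M := f
  have map_comap (p : Submodule k M) : (p.comap g).map g = p :=
    Submodule.map_comap_eq_of_surjective hf p
  constructor
  · rintro ⟨U, sup_eq, inf_eq⟩
    refine ⟨U.map f, ?_, ?_⟩
    · have := congrArg (Submodule.map g) sup_eq
      rwa [Submodule.map_sup, Submodule.map_top, LinearMap.range_eq_top.2 hf,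
        LieIdeal.comap_toSubmodule, map_comap] at this
    · have : J.toSubmodule ⊓ U.toSubmodule.map g =
          (J.toSubmodule.comap g ⊓ U.toSubmodule).map g := by
        rw [inf_comm, Submodule.map_inf_eq_map_inf_comap, inf_comm]
      exact this.trans <| (congrArg (Submodule.map g) inf_eq).trans <|
        LinearMap.le_ker_iff_map.1 le_rfl
  · rintro ⟨V, sup_eq, inf_eq⟩
    refine ⟨V.comap f, ?_, ?_⟩
    · have ker_le : LinearMap.ker g ≤ J.toSubmodule.comap g ⊔ V.toSubmodule.comap g :=
        (LinearMap.ker_le_comap g).trans le_sup_left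
      have := Submodule.comap_map_eq_self ker_le
      rw [Submodule.map_sup, map_comap, map_comap, sup_eq, Submodule.comap_top] at this
      exact this.symm
    · exact congrArg (Submodule.comap g) inf_eq

end Complements

section Twists

variable {L : Type*} [LieRing L] [LieAlgebra k L]

/-- A twist of the quotient map by `I/C` is a homomorphism `δ : L → L/C` that agrees with
`quotHom C` modulo `I/C`. The differences `δ - quotHom C` are the 1-cocycles of `L` with values in
`I/C`. -/
def IsTwist (I C : LieIdeal k L) (δ : L →ₗ⁅k⁆ L ⧸ C) : Prop :=
  ∀ x, δ x - quotHom C x ∈ factor I C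

variable {I C : LieIdeal k L} {δ : L →ₗ⁅k⁆ L ⧸ C}

lemma isTwist_quotHom : IsTwist I C (quotHom C) := fun x => by
  rw [sub_self]
  exact (factor I C).zero_mem

lemma IsTwist.exists_isOneCocycle (hδ : IsTwist I C δ) :
    ∃ β : L →ₗ[k] factor I C, IsOneCocycle (factorAction I C) β ∧
      ∀ x, δ x = quotHom C x + (β x : L ⧸ C) := by
  refine ⟨LinearMap.codRestrict (factor I C).toSubmodule (δ.toLinearMap - (quotHom C).toLinearMap)
    hδ, fun x y => Subtype.ext ?_, fun x => (add_sub_cancel _ _).symm⟩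
  change δ ⁅x, y⁆ - quotHom C ⁅x, y⁆ = ⁅quotHom C x, δ y - quotHom C y⁆ -
    ⁅quotHom C y, δ x - quotHom C x⁆ + ⁅δ x - quotHom C x, δ y - quotHom C y⁆
  rw [LieHom.map_lie, LieHom.map_lie, ← lie_skew (quotHom C y)]
  simp only [lie_sub, sub_lie]
  abel

lemma IsOneCocycle.exists_isTwist {β : L →ₗ[k] factor I C}
    (hβ : IsOneCocycle (factorAction I C) β) :
    ∃ δ, IsTwist I C δ ∧ ∀ x, δ x = quotHom C x + (β x : L ⧸ C) := by
  let δ : L →ₗ⁅k⁆ L ⧸ C :=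
    { (quotHom C).toLinearMap + (factor I C).toSubmodule.subtype ∘ₗ β with
      map_lie' := fun {x y} => by
        change quotHom C ⁅x, y⁆ + (β ⁅x, y⁆ : L ⧸ C) =
          ⁅quotHom C x + (β x : L ⧸ C), quotHom C y + (β y : L ⧸ C)⁆
        have : (β ⁅x, y⁆ : L ⧸ C) = ⁅quotHom C x, (β y : L ⧸ C)⁆ - ⁅quotHom C y, (β x : L ⧸ C)⁆ +
          ⁅(β x : L ⧸ C), (β y : L ⧸ C)⁆ := congrArg Subtype.val (hβ x y)
        rw [this, LieHom.map_lie, lie_add, add_lie, add_lie, ← lie_skew (quotHom C y)]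
        abel }
  have apply (x : L) : δ x = quotHom C x + (β x : L ⧸ C) := rfl
  refine ⟨δ, fun x => ?_, apply⟩
  rw [apply, add_sub_cancel_left]
  exact (β x).2

namespace IsTwist

lemma apply_mem_factor (hδ : IsTwist I C δ) (hCI : C ≤ I) {x : L} :
    δ x ∈ factor I C ↔ x ∈ I := by
  have := (factor I C).toSubmodule.add_mem_iff_right (y := quotHom C x) (hδ x)
  rw [sub_add_cancel] at this
  exact this.trans (quotHom_mem_factor hCI)

lemma comap_factor (hδ : IsTwist I C δ) (hCI : C ≤ I) : (factor I C).comap δ = I :=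
  LieSubmodule.ext _ _ fun _ => LieIdeal.mem_comap.trans (hδ.apply_mem_factor hCI)

lemma ker_le (hδ : IsTwist I C δ) (hCI : C ≤ I) : δ.ker ≤ I :=
  (LieHom.ker_le_comap δ _).trans (hδ.comap_factor hCI).le

lemma factor_sup_range (hδ : IsTwist I C δ) :
    (factor I C).toSubmodule ⊔ δ.range.toSubmodule = ⊤ := by
  refine eq_top_iff.2 fun y _ => ?_
  obtain ⟨x, rfl⟩ := quotHom_surjective C y
  exact Submodule.mem_sup.2
    ⟨-(δ x - quotHom C x), (factor I C).neg_mem (hδ x), δ x, δ.mem_range_self x, by abel⟩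

lemma surjective_of_factor_le (hδ : IsTwist I C δ)
    (h : (factor I C).toSubmodule ≤ δ.range.toSubmodule) : Function.Surjective δ := by
  have range_eq := hδ.factor_sup_range
  rw [sup_eq_right.2 h, LieSubalgebra.toSubmodule_eq_top] at range_eq
  exact (LieHom.range_eq_top δ).1 range_eq

lemma lEquivalent (hδ : IsTwist I C δ) (hCI : C ≤ I) (surjective : Function.Surjective δ) :
    LEquivalent (factorAction I δ.ker) (factorAction I C) := by
  obtain ⟨β, hβ, apply⟩ := hδ.exists_isOneCocycle
  obtain ⟨e, he⟩ : ∃ e : factor I δ.ker ≃ₗ⁅k⁆ factor I C,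
      ∀ x (hx : x ∈ I), e ⟨quotHom δ.ker x, x, hx, rfl⟩ = δ x := by
    refine exists_factor_lieEquiv (fun x => (hδ.apply_mem_factor hCI).2) (fun y hy => ?_)
      fun x _ => LieHom.mem_ker.symm
    obtain ⟨x, rfl⟩ := surjective y
    exact ⟨x, (hδ.apply_mem_factor hCI).1 hy, rfl⟩
  refine LEquivalent.of_isOneCocycle (φ := e) hβ ?_
  rintro x ⟨_, y, hy, rfl⟩
  refine Subtype.ext ((he ⁅x, y⁆ (I.lie_mem hy)).trans ?_)
  rw [LieHom.map_lie, apply x, add_lie, ← he y hy]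
  rfl

lemma exists_isComplement_ker_iff (hδ : IsTwist I C δ) (hCI : C ≤ I)
    (surjective : Function.Surjective δ) :
    (∃ U, IsComplement U I δ.ker) ↔ ∃ V, IsComplement V (factor I C) ⊥ := by
  rw [← exists_isComplement_comap_iff surjective, hδ.comap_factor hCI]

lemma exists_isComplement_factor (hδ : IsTwist I C δ) (hCI : C ≤ I) (hI : I ≤ δ.ker) :
    ∃ V, IsComplement V (factor I C) ⊥ := by
  refine ⟨δ.range, hδ.factor_sup_range, (Submodule.eq_bot_iff _).2 ?_⟩
  rintro _ ⟨hx, x, rfl⟩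
  exact LieHom.mem_ker.1 (hI ((hδ.apply_mem_factor hCI).1 hx))

end IsTwist

lemma exists_isComplement_factor_bot_iff (hCI : C ≤ I) :
    (∃ V, IsComplement V (factor I C) ⊥) ↔ ∃ U, IsComplement U I C := by
  have h := isTwist_quotHom.exists_isComplement_ker_iff hCI (quotHom_surjective C)
  rw [ker_quotHom] at h
  exact h.symm

lemma IsTwist.not_le_ker (hδ : IsTwist I C δ) (hc' : IsCPrimeFactor I C) :
    ¬ I ≤ δ.ker := fun hI =>
  hc'.2 <| (exists_isComplement_factor_bot_iff hc'.1.1).1 (hδ.exists_isComplement_factor hc'.1.1 hI)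

namespace IsSelfCentralizingFactor

lemma mem_cocycleCore (h : IsSelfCentralizingFactor I C) {x : L} :
    x ∈ cocycleCore (factorAction I C) ↔ ∀ δ, IsTwist I C δ → δ x = 0 := by
  rw [CCType.mem_cocycleCore, h.centralizer_eq, ← quotHom_eq_zero]
  constructor
  · rintro ⟨hx, hβ⟩ δ hδ
    obtain ⟨β, isOneCocycle, apply⟩ := hδ.exists_isOneCocycle
    rw [apply, hx, hβ β isOneCocycle, zero_add]
    rfl
  · refine fun hx => ⟨hx _ isTwist_quotHom, fun β hβ => Subtype.ext ?_⟩
    obtain ⟨δ, hδ, apply⟩ := hβ.exists_isTwist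
    have := apply x
    rwa [hx δ hδ, hx _ isTwist_quotHom, zero_add, eq_comm] at this

lemma isCPrimeFactor_socle_iff (h : IsSelfCentralizingFactor I C) :
    IsCPrimeFactor (socle k (L ⧸ C)) ⊥ ↔ IsCPrimeFactor I C := by
  rw [h.socle_eq, IsCPrimeFactor, IsCPrimeFactor, exists_isComplement_factor_bot_iff h.covBy.le,
    isChiefFactor_iff_covBy, bot_covBy_iff]
  exact and_congr_left' (iff_of_true h.isChiefFactor.2 h.isChiefFactor)

/-- The twist is the sum of the quotient map and the cocycle of the equivalence. -/
lemma exists_isTwist_ker_eq (h : IsSelfCentralizingFactor I C) {R : LieIdeal k L} (hR : R ≤ I)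
    (he : LEquivalent (factorAction I R) (factorAction I C)) :
    ∃ δ, IsTwist I C δ ∧ Function.Surjective δ ∧ δ.ker = R := by
  obtain ⟨φ, β, hβ, hφ⟩ := he.exists_isOneCocycle
  obtain ⟨δ, hδ, apply⟩ := hβ.exists_isTwist
  -- On `I`, the difference of the two sides centralizes `I/C`.
  have apply_of_mem (x : L) (hx : x ∈ I) : δ x = φ ⟨quotHom R x, x, hx, rfl⟩ := by
    refine sub_eq_zero.1 (h.eq_zero_of_lie_eq_zero fun s hs => ?_)
    obtain ⟨a, ha⟩ : ∃ a, φ a = ⟨s, hs⟩ := φ.surjective _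
    have lie_eq := congrArg Subtype.val (hφ x a)
    rw [show factorAction I R x a = ⁅(⟨quotHom R x, x, hx, rfl⟩ : factor I R), a⁆ from rfl,
      LieEquiv.map_lie, ha] at lie_eq
    rw [sub_lie, apply, add_lie, sub_eq_zero]
    exact lie_eq.symm
  refine ⟨δ, hδ, hδ.surjective_of_factor_le fun s hs => ?_, LieSubmodule.ext _ _ fun x => ?_⟩
  · obtain ⟨⟨_, x, hx, rfl⟩, ha⟩ : ∃ a, φ a = ⟨s, hs⟩ := φ.surjective _
    exact ⟨x, (apply_of_mem x hx).trans (congrArg Subtype.val ha)⟩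
  · have mem_iff (hx : x ∈ I) : δ x = 0 ↔ x ∈ R := by
      rw [apply_of_mem x hx, ZeroMemClass.coe_eq_zero, map_eq_zero_iff φ φ.injective,
        Subtype.ext_iff]
      exact quotHom_eq_zero
    exact ⟨fun hx => (mem_iff (hδ.ker_le h.covBy.le hx)).1 hx, fun hx => (mem_iff (hR hx)).2 hx⟩

end IsSelfCentralizingFactor

end Twists

section Counting

open Module

variable {V W : Type*} [AddCommGroup V] [Module k V] [FiniteDimensional k V] [AddCommGroup W]
  [Module k W]

lemma surjective_of_finrank_ker_le {f g : V →ₗ[k] W} (hg : Function.Surjective g)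
    (h : finrank k (LinearMap.ker f) ≤ finrank k (LinearMap.ker g)) : Function.Surjective f := by
  have := Module.Finite.of_surjective g hg
  have rank_f := f.finrank_range_add_finrank_ker
  have rank_g := g.finrank_range_add_finrank_ker
  rw [LinearMap.range_eq_top.2 hg, finrank_top] at rank_g
  refine LinearMap.range_eq_top.1 <|
    Submodule.eq_top_of_finrank_eq (le_antisymm (Submodule.finrank_le _) ?_)
  lia

lemma finrank_le_of_inf_le_of_sup_eq_top {p q m : Submodule k V} (hp : p ⊓ m ≤ q)
    (hq : q ⊔ m = ⊤) : finrank k p ≤ finrank k q := by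
  have dim_p := Submodule.finrank_sup_add_finrank_inf_eq p m
  have dim_q := Submodule.finrank_sup_add_finrank_inf_eq q m
  have inf_le := Submodule.finrank_mono (le_inf hp inf_le_right)
  have sup_le := Submodule.finrank_le (p ⊔ m)
  rw [hq, finrank_top] at dim_q
  lia

lemma exists_sup_eq_inf_eq_of_sInf_le {α : Type*} [CompleteLattice α] [IsLowerModularLattice α]
    [WellFoundedLT α] {S : Set α} {a b : α} (hS : ∀ r ∈ S, r ⋖ a) (hb : sInf S ≤ b)
    (hab : ¬ a ≤ b) : ∃ r ∈ S, ∃ c, c ⊔ r = a ∧ c ⊓ b = c ⊓ r := by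
  obtain ⟨c, ⟨hca, hcb⟩, minimal⟩ :=
    wellFounded_lt.has_min {c | c ≤ a ∧ ¬ c ≤ b} ⟨a, le_rfl, hab⟩
  obtain ⟨r, hr, hcr⟩ : ∃ r ∈ S, ¬ c ≤ r := by
    by_contra! h
    exact hcb ((le_sInf h).trans hb)
  have sup_eq : c ⊔ r = a :=
    ((hS r hr).eq_or_eq le_sup_right (sup_le hca (hS r hr).le)).resolve_left
      fun h => hcr (sup_eq_right.1 h)
  have inf_le : c ⊓ r ≤ b := by
    by_contra h
    exact minimal _ ⟨inf_le_left.trans hca, h⟩ (inf_lt_left.2 hcr)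
  have inf_covBy : c ⊓ r ⋖ c := inf_covBy_of_covBy_sup_right (sup_eq ▸ hS r hr)
  exact ⟨r, hr, c, sup_eq, (inf_covBy.eq_or_eq (le_inf inf_le_left inf_le)
    inf_le_left).resolve_right fun h => hcb (inf_eq_left.1 h)⟩

end Counting

section Crown

open Module

variable {L : Type*} [LieRing L] [LieAlgebra k L]
variable {A : Type*} [LieRing A] [LieAlgebra k A] {θ : L →ₗ⁅k⁆ LieDerivation k A A}
variable {C R : LieIdeal k L} {δ : L →ₗ⁅k⁆ L ⧸ C}

lemma isSelfCentralizingFactor_of_mem_crownKernels (hirr : IsIrreducibleLAlgebra θ)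
    (hA : ¬ IsLieAbelian A) (hC : C ∈ crownKernels θ) :
    IsSelfCentralizingFactor (innerIdeal θ) C :=
  hC.2.1.isSelfCentralizingFactor hirr hA hC.1

lemma mem_cocycleCore_iff_isTwist (hirr : IsIrreducibleLAlgebra θ) (hA : ¬ IsLieAbelian A)
    (hC : C ∈ crownKernels θ) {x : L} :
    x ∈ cocycleCore θ ↔ ∀ δ, IsTwist (innerIdeal θ) C δ → δ x = 0 := by
  rw [hC.2.1.cocycleCore_eq]
  exact (isSelfCentralizingFactor_of_mem_crownKernels hirr hA hC).mem_cocycleCore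

variable [FiniteDimensional k L]

lemma mem_crownKernels_iff_isTwist (hirr : IsIrreducibleLAlgebra θ) (hA : ¬ IsLieAbelian A)
    (hC : C ∈ crownKernels θ) :
    R ∈ crownKernels θ ↔
      ∃ δ, IsTwist (innerIdeal θ) C δ ∧ Function.Surjective δ ∧ δ.ker = R := by
  constructor
  · exact fun hR => (isSelfCentralizingFactor_of_mem_crownKernels hirr hA hC).exists_isTwist_ker_eq
      hR.1 (hR.2.1.symm.trans hC.2.1)
  · rintro ⟨δ, hδ, surjective, rfl⟩
    exact (mem_crownKernels_iff hirr hA).2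
      ⟨hδ.ker_le hC.1, hC.2.1.trans (hδ.lEquivalent hC.1 surjective).symm⟩

lemma isCPrimeFactor_iff_of_mem_crownKernels (hirr : IsIrreducibleLAlgebra θ)
    (hA : ¬ IsLieAbelian A) (hC : C ∈ crownKernels θ) (hR : R ∈ crownKernels θ) :
    IsCPrimeFactor (innerIdeal θ) R ↔ IsCPrimeFactor (innerIdeal θ) C := by
  have isChiefFactor {K : LieIdeal k L} (hK : K ∈ crownKernels θ) :=
    (isSelfCentralizingFactor_of_mem_crownKernels hirr hA hK).isChiefFactor
  obtain ⟨δ, hδ, surjective, rfl⟩ := (mem_crownKernels_iff_isTwist hirr hA hC).1 hR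
  rw [IsCPrimeFactor, IsCPrimeFactor, hδ.exists_isComplement_ker_iff hC.1 surjective,
    exists_isComplement_factor_bot_iff hC.1]
  exact and_congr_left' (iff_of_true (isChiefFactor hR) (isChiefFactor hC))

/-- The crown kernels have codimension `dim I/C` in `I`, while `δ.ker` has smaller codimension
unless `δ` is onto. -/
lemma IsTwist.surjective_of_crownBottom_le_ker (hδ : IsTwist (innerIdeal θ) C δ)
    (hirr : IsIrreducibleLAlgebra θ) (hA : ¬ IsLieAbelian A) (hC : C ∈ crownKernels θ)
    (hD : crownBottom θ ≤ δ.ker) (hI : ¬ innerIdeal θ ≤ δ.ker) : Function.Surjective δ := by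
  have := LieSubmodule.wellFoundedLT_of_isArtinian k L L
  obtain ⟨R, hR, J, sup_eq, inf_eq⟩ := exists_sup_eq_inf_eq_of_sInf_le
    (fun R hR => (isSelfCentralizingFactor_of_mem_crownKernels hirr hA hR).covBy) hD hI
  obtain ⟨ε, -, ε_surjective, rfl⟩ := (mem_crownKernels_iff_isTwist hirr hA hC).1 hR
  refine surjective_of_finrank_ker_le (f := δ.toLinearMap) ε_surjective ?_
  have sup_le : J ⊔ δ.ker ≤ J ⊔ ε.ker := by
    rw [sup_eq]
    exact _root_.sup_le (le_sup_left.trans sup_eq.le) (hδ.ker_le hC.1)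
  have dim_δ := Submodule.finrank_sup_add_finrank_inf_eq J.toSubmodule δ.ker.toSubmodule
  have dim_ε := Submodule.finrank_sup_add_finrank_inf_eq J.toSubmodule ε.ker.toSubmodule
  rw [← LieSubmodule.sup_toSubmodule, ← LieSubmodule.inf_toSubmodule] at dim_δ dim_ε
  rw [inf_eq] at dim_δ
  have : finrank k (J ⊔ δ.ker).toSubmodule ≤ finrank k (J ⊔ ε.ker).toSubmodule :=
    Submodule.finrank_mono sup_le
  change finrank k δ.ker.toSubmodule ≤ finrank k ε.ker.toSubmodule
  lia

lemma cocycleCore_lt_crownBottom_iff (hirr : IsIrreducibleLAlgebra θ) (hA : ¬ IsLieAbelian A)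
    (hC : C ∈ crownKernels θ) (hc' : IsCPrimeFactor (innerIdeal θ) C) :
    cocycleCore θ < crownBottom θ ↔
      ∃ δ, IsTwist (innerIdeal θ) C δ ∧ ¬ Function.Surjective δ := by
  have mem_core {x : L} := mem_cocycleCore_iff_isTwist hirr hA hC (x := x)
  have mem_kernels {R : LieIdeal k L} := mem_crownKernels_iff_isTwist hirr hA hC (R := R)
  constructor
  · intro hlt
    obtain ⟨x, hxD, hxE⟩ := SetLike.not_le_iff_exists.1 hlt.not_ge
    rw [mem_core] at hxE
    push Not at hxE
    obtain ⟨δ, hδ, hδx⟩ := hxE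
    refine ⟨δ, hδ, fun surjective => hδx ?_⟩
    exact sInf_le (mem_kernels.2 ⟨δ, hδ, surjective, rfl⟩) hxD
  · rintro ⟨δ, hδ, not_surjective⟩
    refine lt_of_le_not_ge (le_sInf fun R hR x hx => ?_) fun hle => not_surjective ?_
    · obtain ⟨ε, hε, -, rfl⟩ := mem_kernels.1 hR
      exact LieHom.mem_ker.2 (mem_core.1 hx ε hε)
    · exact hδ.surjective_of_crownBottom_le_ker hirr hA hC
        (fun x hx => LieHom.mem_ker.2 (mem_core.1 (hle hx) δ hδ)) (hδ.not_le_ker hc')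

end Crown

section CrossingComplements

variable {L : Type*} [LieRing L] [LieAlgebra k L]
variable {A B C D I N X : LieIdeal k L} {M : LieSubalgebra k L}

lemma IsComplement.le_toSubmodule (hM : IsComplement M X N) : N.toSubmodule ≤ M.toSubmodule :=
  hM.2.ge.trans inf_le_right

lemma Covers.isComplement (h : Covers A B C D) (hM : IsComplement M A B) :
    IsComplement M C D := by
  obtain ⟨rfl, rfl⟩ := h
  have hBM := hM.le_toSubmodule
  have sup_eq := hM.1
  rw [LieSubmodule.sup_toSubmodule, sup_comm, ← sup_assoc, sup_eq_left.2 hBM, sup_comm] at sup_eq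
  refine ⟨sup_eq, ?_⟩
  rw [LieSubmodule.inf_toSubmodule]
  refine le_antisymm (le_inf ?_ inf_le_left) (le_inf inf_le_right (inf_le_left.trans hBM))
  rw [← hM.2]
  exact inf_le_inf_right _ (LieSubmodule.toSubmodule_le_toSubmodule _ _ |>.2 le_sup_right)

lemma Covers.isComplement_of_le (h : Covers I C X N) (hM : IsComplement M X N)
    (hCM : C.toSubmodule ≤ M.toSubmodule) : IsComplement M I C := by
  obtain ⟨rfl, rfl⟩ := h
  rw [IsComplement, LieSubmodule.sup_toSubmodule]
  refine ⟨by rw [sup_assoc, hM.1, sup_top_eq], ?_⟩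
  rw [sup_inf_assoc_of_le _ hCM, hM.2, sup_eq_left, LieSubmodule.inf_toSubmodule]
  exact inf_le_left

lemma isCoatom_of_isComplement (hXN : N ⋖ X) (hN : C ⊓ X ≤ N) (hM : IsComplement M X N)
    (hCM : C.toSubmodule ⊔ M.toSubmodule = ⊤) : IsCoatom M := by
  have hNM := hM.le_toSubmodule
  refine ⟨?_, fun T hT => ?_⟩
  · rintro rfl
    exact hXN.lt.not_ge fun x hx => hM.2.le ⟨hx, trivial⟩
  have hMT : M.toSubmodule ≤ T.toSubmodule := hT.le
  have lie_mem (y x : L) (hx : x ∈ X.toSubmodule ⊓ T.toSubmodule) :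
      ⁅y, x⁆ ∈ X.toSubmodule ⊓ T.toSubmodule := by
    obtain ⟨c, hc, m, hm, rfl⟩ := Submodule.mem_sup.1 (hCM.ge (Submodule.mem_top (x := y)))
    rw [add_lie]
    exact add_mem ⟨X.lie_mem hx.1, hMT (hNM (hN ⟨lie_mem_left k L C c x hc, X.lie_mem hx.1⟩))⟩
      ⟨X.lie_mem hx.1, T.lie_mem (hMT hm) hx.2⟩
  let J : LieIdeal k L :=
    { X.toSubmodule ⊓ T.toSubmodule with lie_mem := fun {y x} hx => lie_mem y x hx }
  have eq_sup : T.toSubmodule = J.toSubmodule ⊔ M.toSubmodule := by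
    rw [sup_comm]
    change _ = _ ⊔ X.toSubmodule ⊓ _
    rw [← sup_inf_assoc_of_le _ hMT, sup_comm, hM.1, top_inf_eq]
  obtain hJ | hJ := hXN.eq_or_eq (c := J) (fun x hx => ⟨hXN.le hx, hMT (hNM hx)⟩) fun x hx => hx.1
  · rw [hJ, sup_eq_right.2 hNM] at eq_sup
    exact absurd (show T ≤ M from eq_sup.le) hT.not_ge
  · rwa [hJ, hM.1, LieSubalgebra.toSubmodule_eq_top] at eq_sup

/-- The twist sends `x + m` to `m + C`, for `x ∈ X` and `m ∈ M`. -/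
lemma Covers.exists_isTwist (h : Covers I C X N) (hM : IsComplement M X N) :
    ∃ δ, IsTwist I C δ ∧ X ≤ δ.ker ∧ ∀ m ∈ M, δ m = quotHom C m := by
  have exists_add (y : L) : ∃ x ∈ X, ∃ m ∈ M, x + m = y :=
    Submodule.mem_sup.1 (hM.1.ge Submodule.mem_top)
  have surjective : Function.Surjective ((quotHom X).comp M.incl) := fun z => by
    obtain ⟨y, rfl⟩ := quotHom_surjective X z
    obtain ⟨x, hx, m, hm, rfl⟩ := exists_add y
    exact ⟨⟨m, hm⟩, by rw [map_add, quotHom_eq_zero.2 hx, zero_add]; rfl⟩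
  obtain ⟨g, hg⟩ : ∃ g : L ⧸ X →ₗ⁅k⁆ L ⧸ C, ∀ m : M, g (quotHom X m) = quotHom C m := by
    refine exists_lieHom_of_ker_le (g := (quotHom C).comp M.incl) surjective fun m hm => ?_
    have mem_N : (m : L) ∈ N := hM.2.le ⟨quotHom_eq_zero.1 hm, m.2⟩
    exact quotHom_eq_zero.2 (h.2.ge mem_N).1
  have apply_X {x : L} (hx : x ∈ X) : g (quotHom X x) = 0 := by
    rw [quotHom_eq_zero.2 hx, map_zero]
  refine ⟨g.comp (quotHom X), fun y => ?_, fun x hx => apply_X hx, fun m hm => hg ⟨m, hm⟩⟩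
  obtain ⟨x, hx, m, hm, rfl⟩ := exists_add y
  rw [LieHom.comp_apply, map_add, map_add, apply_X hx, zero_add, hg ⟨m, hm⟩, map_add,
    sub_add_cancel_right]
  exact (factor I C).neg_mem ((quotHom_mem_factor (h.1 ▸ le_sup_left)).2 (h.1 ▸
    LieSubmodule.mem_sup_right hx))

/-- If the twist defined by a complement `M` of `X/N` were onto, then `C + M = L` and `M` would be
a maximal complement of `A/B`. -/
lemma Covers.exists_isTwist_not_surjective (hIX : Covers I C X N) (hXA : Covers X N A B)
    (hc : IsCFactor X N) (hm : IsMPrimeFactor A B) :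
    ∃ δ, IsTwist I C δ ∧ ¬ Function.Surjective δ := by
  obtain ⟨hc, M, hM⟩ := hc
  obtain ⟨δ, hδ, hX, apply⟩ := hIX.exists_isTwist hM
  refine ⟨δ, hδ, fun surjective => hm.2 ⟨M, ?_, hXA.isComplement hM⟩⟩
  refine isCoatom_of_isComplement (isChiefFactor_iff_covBy.1 hc) hIX.2.le hM ?_
  refine eq_top_iff.2 fun y _ => ?_
  obtain ⟨z, hz⟩ := surjective (quotHom C y)
  obtain ⟨x, hx, m, hm, rfl⟩ := Submodule.mem_sup.1 (hM.1.ge (Submodule.mem_top (x := z)))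
  rw [map_add, LieHom.mem_ker.1 (hX hx), zero_add, apply m hm, eq_comm, quotHom_eq_quotHom] at hz
  exact Submodule.mem_sup.2 ⟨y - m, hz, m, hm, sub_add_cancel y m⟩

end CrossingComplements

section NonSurjectiveTwists

variable {L : Type*} [LieRing L] [LieAlgebra k L]
variable {C I : LieIdeal k L} {δ : L →ₗ⁅k⁆ L ⧸ C}

lemma IsTwist.exists_isComplement_ker (hδ : IsTwist I C δ) (h : Covers I C δ.ker (δ.ker ⊓ C)) :
    ∃ M, IsComplement M δ.ker (δ.ker ⊓ C) := by
  let M : LieSubalgebra k L :=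
    { LinearMap.eqLocus δ.toLinearMap (quotHom C).toLinearMap with
      lie_mem' := fun {x y} (hx : δ x = quotHom C x) (hy : δ y = quotHom C y) =>
        show δ ⁅x, y⁆ = quotHom C ⁅x, y⁆ by rw [LieHom.map_lie, LieHom.map_lie, hx, hy] }
  refine ⟨M, eq_top_iff.2 fun y _ => ?_, le_antisymm (fun x hx => ⟨hx.1, ?_⟩)
    fun x hx => ⟨hx.1, ?_⟩⟩
  · obtain ⟨z, hz, hzy⟩ := hδ y
    obtain ⟨c, hc, x, hx, rfl⟩ := (LieSubmodule.mem_sup _ _ _).1 (h.1.le hz)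
    refine Submodule.mem_sup.2 ⟨-x, neg_mem hx, y + x, ?_, neg_add_cancel_comm_assoc x y⟩
    change quotHom C (c + x) = δ y - quotHom C y at hzy
    rw [map_add, quotHom_eq_zero.2 hc, zero_add] at hzy
    change δ (y + x) = quotHom C (y + x)
    rw [map_add, map_add, LieHom.mem_ker.1 hx, add_zero, hzy, add_sub_cancel]
  · exact (LieHom.mem_ker.1 hx.1).trans (quotHom_eq_zero.2 hx.2).symm
  · exact quotHom_eq_zero.1 (Eq.trans (Eq.symm hx.2) (LieHom.mem_ker.1 hx.1))

variable [FiniteDimensional k L]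

open Module in
lemma surjective_of_finrank_ker_le_finrank
    (h : finrank k δ.ker.toSubmodule ≤ finrank k C.toSubmodule) : Function.Surjective δ :=
  surjective_of_finrank_ker_le (f := δ.toLinearMap) (g := (quotHom C).toLinearMap)
    (quotHom_surjective C) <| by
      change _ ≤ finrank k (quotHom C).ker.toSubmodule
      rwa [ker_quotHom]

lemma IsTwist.covers_ker (hδ : IsTwist I C δ) (hCI : C ⋖ I) (h : ¬ Function.Surjective δ) :
    Covers I C δ.ker (δ.ker ⊓ C) := by
  have not_ker_le : ¬ δ.ker ≤ C := fun hle =>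
    h (surjective_of_finrank_ker_le_finrank (Submodule.finrank_mono hle))
  refine ⟨?_, inf_comm _ _⟩
  exact ((hCI.eq_or_eq le_sup_left (sup_le hCI.le (hδ.ker_le hCI.le))).resolve_left
    fun h => not_ker_le (sup_eq_left.1 h)).symm

/-- A maximal complement of `δ.ker` modulo `δ.ker ⊓ C` either contains `C` and complements `I/C`,
or it supplements `C`, and then `δ.ker` is no larger than `C`. -/
lemma IsTwist.isMPrimeFactor_ker (hδ : IsTwist I C δ) (hc' : IsCPrimeFactor I C)
    (h : ¬ Function.Surjective δ) : IsMPrimeFactor δ.ker (δ.ker ⊓ C) := by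
  have hCI := isChiefFactor_iff_covBy.1 hc'.1
  have covers := hδ.covers_ker hCI h
  refine ⟨isChiefFactor_iff_covBy.2 (covers.covBy_iff.1 hCI), ?_⟩
  rintro ⟨M, coatom, hM⟩
  by_cases hCM : C.toSubmodule ≤ M.toSubmodule
  · exact hc'.2 ⟨M, covers.isComplement_of_le hM hCM⟩
  · refine h (surjective_of_finrank_ker_le_finrank ?_)
    exact finrank_le_of_inf_le_of_sup_eq_top (hM.2.le.trans fun x hx => hx.2)
      (sup_eq_top_of_isCoatom coatom hCM)

end NonSurjectiveTwists

section MRelated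

variable {L : Type*} [LieRing L] [LieAlgebra k L] {A B C D H K : LieIdeal k L}

lemma Covers.refl (h : K ≤ H) : Covers H K H K := ⟨(sup_eq_right.2 h).symm, inf_eq_left.2 h⟩

lemma Covers.mRelated (h : Covers A B C D) (hc : IsChiefFactor A B)
    (hF : IsFrattiniFactor A B → IsFrattiniFactor C D) : MRelated C D A B := by
  by_cases frattini : IsFrattiniFactor A B
  · have hCD := isChiefFactor_iff_covBy.2 (h.covBy_iff.1 (isChiefFactor_iff_covBy.1 hc))
    exact Or.inr (Or.inr (Or.inl ⟨C, D, hCD, hF frattini, Covers.refl hCD.1, h⟩))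
  · exact Or.inl ⟨A, B, hc.isSupplementedChiefFactor frattini, h, Covers.refl hc.1⟩

lemma MRelated.refl (hc : IsChiefFactor H K) : MRelated H K H K :=
  (Covers.refl hc.1).mRelated hc id

lemma covers_sup {X W₀ W₁ : LieIdeal k L} (hW : W₀ ≤ W₁) (hX : X ⊓ W₁ ≤ W₀) :
    Covers (X ⊔ W₁) (X ⊔ W₀) W₁ W₀ := by
  refine ⟨by rw [sup_assoc, sup_eq_right.2 hW], ?_⟩
  rw [sup_comm, sup_inf_assoc_of_le X hW, sup_eq_left.2 hX]

/-- Modulo `D`, the ideals `B` and `C` centralize each other and `C` is abelian, so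
`⁅c + u, c' + u'⁆ = ⁅u, u'⁆` whenever `c + u` and `c' + u'` lie in `B`, with `c, c' ∈ C` and
`u, u' ∈ U`. -/
lemma Covers.le_of_sup_eq_top (h : Covers A B C D) (hD : D ⋖ B) (hn : IsNonabelianFactor B D)
    (ab : IsLieAbelian (factor C D)) {U : LieSubalgebra k L} (hDU : D.toSubmodule ≤ U.toSubmodule)
    (hCU : C.toSubmodule ⊔ U.toSubmodule = ⊤) : B.toSubmodule ≤ U.toSubmodule := by
  have lie_mem_D {c b : L} (hc : c ∈ C) (hb : b ∈ B) : ⁅c, b⁆ ∈ D :=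
    h.2.le ⟨B.lie_mem hb, lie_mem_left k L C c b hc⟩
  have lie_mem_U (b : L) (hb : b ∈ B) (b' : L) (hb' : b' ∈ B) : ⁅b, b'⁆ ∈ U := by
    obtain ⟨c, hc, u, hu, rfl⟩ := Submodule.mem_sup.1 (hCU.ge (Submodule.mem_top (x := b)))
    obtain ⟨c', hc', u', hu', rfl⟩ := Submodule.mem_sup.1 (hCU.ge (Submodule.mem_top (x := b')))
    have expand : ⁅c + u, c' + u'⁆ =
        ⁅u, u'⁆ + (⁅c, c' + u'⁆ - ⁅c', c + u⁆ - ⁅c, c'⁆) := by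
      simp only [lie_add, add_lie]
      rw [← lie_skew u c', ← lie_skew c c']
      abel
    rw [expand]
    exact add_mem (U.lie_mem hu hu') <| hDU <| sub_mem
      (sub_mem (lie_mem_D hc hb') (lie_mem_D hc' hb)) (isLieAbelian_factor_iff.1 ab c hc c' hc')
  rw [← hn.sup_lie hD, LieSubmodule.sup_toSubmodule, LieSubmodule.lieIdeal_oper_eq_linear_span']
  refine sup_le hDU (Submodule.span_le.2 ?_)
  rintro _ ⟨b, hb, b', hb', rfl⟩
  exact lie_mem_U b hb b' hb'

variable [FiniteDimensional k L]

lemma Covers.isFrattiniFactor (h : Covers A B C D) (hD : D ⋖ B) (hn : IsNonabelianFactor B D)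
    (hc : IsChiefFactor A B) (hF : IsFrattiniFactor A B) : IsFrattiniFactor C D := by
  have ab : IsLieAbelian (factor C D) := by
    by_contra hn
    exact not_isFrattiniFactor hc (h.isNonabelianFactor_iff.2 hn) hF
  rw [isFrattiniFactor_iff] at hF ⊢
  intro U hU hDU
  by_contra hCU
  have hBU := h.le_of_sup_eq_top hD hn ab hDU (sup_eq_top_of_isCoatom hU hCU)
  have hCA : C ≤ A := h.1 ▸ le_sup_right
  exact hCU (le_trans hCA (hF U hU hBU))

lemma mRelated_sup {X W₀ W₁ : LieIdeal k L} (hX : X ⊓ C ⋖ X)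
    (hn : IsNonabelianFactor X (X ⊓ C)) (hN : X ⊓ C ≤ W₀) (hW : W₀ ⋖ W₁) (hWC : W₁ ≤ C) :
    X ⊔ W₀ ⋖ X ⊔ W₁ ∧ MRelated W₁ W₀ (X ⊔ W₁) (X ⊔ W₀) := by
  have covers := covers_sup hW.le ((inf_le_inf_left X hWC).trans hN)
  have covers_X : Covers (X ⊔ W₀) W₀ X (X ⊓ C) := by
    refine ⟨sup_comm _ _, ?_⟩
    rw [inf_comm]
    exact le_antisymm (inf_le_inf_left X (hW.le.trans hWC)) (le_inf inf_le_left hN)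
  have covBy := covers.covBy_iff.2 hW
  have hc := isChiefFactor_iff_covBy.2 covBy
  exact ⟨covBy, covers.mRelated hc fun hF =>
    covers.isFrattiniFactor (covers_X.covBy_iff.2 hX) (covers_X.isNonabelianFactor_iff.2 hn) hc hF⟩

end MRelated

section SemidirectSums

variable {L : Type*} [LieRing L] [LieAlgebra k L] {I C : LieIdeal k L} {δ : L →ₗ⁅k⁆ L ⧸ C}

lemma mem_map_comap_quotHom {T : LieSubalgebra k (L ⧸ C)} {y : L ⧸ C} :
    y ∈ (T.comap (quotHom C)).map (quotHom C) ↔ y ∈ T := by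
  constructor
  · rintro ⟨x, hx, rfl⟩
    exact hx
  · intro hy
    obtain ⟨x, rfl⟩ := quotHom_surjective C y
    exact ⟨x, hy, rfl⟩

/-- The homomorphism `x ↦ (x + C - δ x, δ x)` from `L` to the natural semidirect sum of `I/C` by
the image of a twist `δ`. The image is written as `F/C`, for `F` the preimage of `δ.range` in `L`,
to fit the domain of `subalgebraAction`. -/
def IsTwist.toSemiDirectSum (hδ : IsTwist I C δ) :
    L →ₗ⁅k⁆ SemiDirectSum (factor I C) ((δ.range.comap (quotHom C)).map (quotHom C))
      (subalgebraAction I C (δ.range.comap (quotHom C))) where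
  toFun x := ⟨⟨quotHom C x - δ x, sub_mem_comm_iff.1 (hδ x)⟩,
    ⟨δ x, mem_map_comap_quotHom.2 ⟨x, rfl⟩⟩⟩
  map_add' x y := by
    ext
    · change quotHom C (x + y) - δ (x + y) = (quotHom C x - δ x) + (quotHom C y - δ y)
      rw [map_add, map_add, add_sub_add_comm]
    · exact map_add δ x y
  map_smul' t x := by
    ext
    · change quotHom C (t • x) - δ (t • x) = t • (quotHom C x - δ x)
      rw [map_smul, map_smul, smul_sub]
    · exact map_smul δ t x
  map_lie' := by
    intro x y
    ext
    · change quotHom C ⁅x, y⁆ - δ ⁅x, y⁆ = ⁅quotHom C x - δ x, quotHom C y - δ y⁆ +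
        ⁅δ x, quotHom C y - δ y⁆ - ⁅δ y, quotHom C x - δ x⁆
      rw [LieHom.map_lie, LieHom.map_lie, ← lie_skew (δ y)]
      simp only [lie_sub, sub_lie]
      abel
    · exact LieHom.map_lie δ x y

lemma IsTwist.ker_toSemiDirectSum (hδ : IsTwist I C δ) :
    hδ.toSemiDirectSum.ker = δ.ker ⊓ C := by
  ext x
  rw [LieHom.mem_ker, LieSubmodule.mem_inf, LieHom.mem_ker, ← quotHom_eq_zero]
  constructor
  · intro hx
    have right_eq : δ x = 0 := congrArg (fun p => (p.right : L ⧸ C)) hx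
    have left_eq : quotHom C x - δ x = 0 := congrArg (fun p => (p.left : L ⧸ C)) hx
    exact ⟨right_eq, (sub_eq_zero.1 left_eq).trans right_eq⟩
  · rintro ⟨hx, hxC⟩
    ext
    · change quotHom C x - δ x = 0
      rw [hx, hxC, sub_zero]
    · exact hx

lemma IsTwist.toSemiDirectSum_surjective (hδ : IsTwist I C δ)
    (h : Covers I C δ.ker (δ.ker ⊓ C)) : Function.Surjective hδ.toSemiDirectSum := by
  rintro ⟨⟨s, hs⟩, ⟨t, ht⟩⟩
  obtain ⟨y, rfl⟩ := mem_map_comap_quotHom.1 ht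
  obtain ⟨z, hz, hzs⟩ := (factor I C).add_mem hs (hδ y)
  obtain ⟨c, hc, x, hx, rfl⟩ := (LieSubmodule.mem_sup _ _ _).1 (h.1.le hz)
  change quotHom C (c + x) = s + (δ y - quotHom C y) at hzs
  rw [map_add, quotHom_eq_zero.2 hc, zero_add] at hzs
  refine ⟨y + x, ?_⟩
  ext
  · change quotHom C (y + x) - δ (y + x) = s
    rw [map_add, map_add, hzs, LieHom.mem_ker.1 hx]
    abel
  · change δ (y + x) = δ y
    rw [map_add, LieHom.mem_ker.1 hx, add_zero]

lemma IsTwist.nonempty_lieEquiv_semiDirectSum (hδ : IsTwist I C δ)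
    (h : Covers I C δ.ker (δ.ker ⊓ C)) :
    Nonempty ((L ⧸ (δ.ker ⊓ C)) ≃ₗ⁅k⁆ SemiDirectSum (factor I C)
      ((δ.range.comap (quotHom C)).map (quotHom C))
      (subalgebraAction I C (δ.range.comap (quotHom C)))) :=
  have ⟨e, _⟩ := exists_lieEquiv_of_ker_eq (quotHom_surjective (δ.ker ⊓ C))
    (hδ.toSemiDirectSum_surjective h) ((ker_quotHom _).trans hδ.ker_toSemiDirectSum.symm)
  ⟨e⟩

lemma IsTwist.isSupplement_comap_range (hδ : IsTwist I C δ) (hCI : C ≤ I) :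
    IsSupplement (δ.range.comap (quotHom C)) I C := by
  refine ⟨eq_top_iff.2 fun y _ => ?_, le_inf hCI fun x hx => ⟨0, ?_⟩⟩
  · obtain ⟨z, hz, hzy⟩ := hδ y
    refine Submodule.mem_sup.2 ⟨-z, neg_mem hz, y + z, ⟨y, ?_⟩, neg_add_cancel_comm_assoc z y⟩
    change quotHom C z = δ y - quotHom C y at hzy
    change δ y = quotHom C (y + z)
    rw [map_add, hzy, add_sub_cancel]
  · exact (map_zero δ).trans (quotHom_eq_zero.2 hx).symm

variable [FiniteDimensional k L]

lemma IsTwist.isMixedPair (hδ : IsTwist I C δ) (hI : IsSelfCentralizingFactor I C)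
    (hc' : IsCPrimeFactor I C) (h : ¬ Function.Surjective δ) :
    IsMixedPair I C δ.ker (δ.ker ⊓ C) := by
  have covers := hδ.covers_ker hI.covBy h
  have chief := isChiefFactor_iff_covBy.2 (covers.covBy_iff.1 hI.covBy)
  have hc : IsCFactor δ.ker (δ.ker ⊓ C) := ⟨chief, hδ.exists_isComplement_ker covers⟩
  have hrefl := Covers.refl hI.covBy.le
  exact ⟨hI.isNonabelianFactor, covers.isNonabelianFactor_iff.1 hI.isNonabelianFactor, hc', hc,
    I, C, hc', hrefl, covers, I, C, δ.ker, δ.ker ⊓ C,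
    ⟨hI.innerIdeal_eq.symm.trans covers.lEquivalent.innerIdeal_eq.symm,
      hI.centralizer_eq.symm.trans covers.centralizer_eq⟩,
    ⟨hrefl, hc'⟩, ⟨hδ.ker_le hI.covBy.le, rfl, Covers.refl chief.1, covers, hc⟩,
    ⟨_, hδ.isSupplement_comap_range hI.covBy.le, hδ.nonempty_lieEquiv_semiDirectSum covers⟩,
    hI.isPrimitiveTypeTwo, hI.socle_eq⟩

end SemidirectSums

section MatchedSeries

variable {α : Type*} [PartialOrder α] {r m : α × α → α × α → Prop}
variable {p q : RelSeries {(a, b) : α × α | a ⋖ b}}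

lemma exists_relSeries_covBy [WellFoundedLT α] [WellFoundedGT α] {a b : α} (h : a ≤ b) :
    ∃ p : RelSeries {(a, b) : α × α | a ⋖ b}, p.head = a ∧ p.last = b := by
  obtain ⟨f, hf, n, hn, step⟩ := exists_covBy_seq_of_wellFoundedLT_wellFoundedGT_of_le h
  exact ⟨⟨n, fun i => f i, fun i => step i i.2⟩, hf, hn⟩

/-- The end points of the `i`-th step of a maximal chain. -/
def stepPair (p : RelSeries {(a, b) : α × α | a ⋖ b}) (i : Fin p.length) : α × α :=
  (p i.castSucc, p i.succ)

lemma exists_smash (h : p.last = q.head) :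
    ∃ t : RelSeries {(a, b) : α × α | a ⋖ b}, t.head = p.head ∧ t.last = q.last ∧
      ∃ e : Fin p.length ⊕ Fin q.length ≃ Fin t.length,
        ∀ s, stepPair t (e s) = Sum.elim (stepPair p) (stepPair q) s :=
  ⟨p.smash q h, RelSeries.head_smash h, RelSeries.last_smash h, finSumFinEquiv, fun
    | .inl i => Prod.ext (RelSeries.smash_castAdd h i) (RelSeries.smash_succ_castAdd h i)
    | .inr i => Prod.ext (RelSeries.smash_natAdd h i) (RelSeries.smash_succ_natAdd h i)⟩

/-- The steps of two maximal chains correspond under a bijection that pairs only steps related by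
`r`, and pairs some two steps related by `m`. -/
def StepsMatched (r m : α × α → α × α → Prop) (p q : RelSeries {(a, b) : α × α | a ⋖ b}) : Prop :=
  ∃ e : Fin p.length ≃ Fin q.length,
    (∀ i, r (stepPair p i) (stepPair q (e i))) ∧ ∃ i, m (stepPair p i) (stepPair q (e i))

lemma StepsMatched.exists_smash_smash (h : StepsMatched r m p q)
    (hr : ∀ x : α × α, x.1 ⋖ x.2 → r x x) {s t : RelSeries {(a, b) : α × α | a ⋖ b}}
    (hsp : s.last = p.head) (hpt : p.last = t.head) (hsq : s.last = q.head)
    (hqt : q.last = t.head) :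
    ∃ p' q', StepsMatched r m p' q' ∧ p'.head = s.head ∧ p'.last = t.last ∧ q'.head = s.head ∧
      q'.last = t.last := by
  obtain ⟨e, related, i, marked⟩ := h
  obtain ⟨p₁, head₁, last₁, e₁, pair₁⟩ := exists_smash hpt
  obtain ⟨p₂, head₂, last₂, e₂, pair₂⟩ := exists_smash (hsp.trans head₁.symm)
  obtain ⟨q₁, head₃, last₃, e₃, pair₃⟩ := exists_smash hqt
  obtain ⟨q₂, head₄, last₄, e₄, pair₄⟩ := exists_smash (hsq.trans head₃.symm)
  let e' := (Equiv.refl (Fin s.length)).sumCongr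
    (e₁.symm.trans ((e.sumCongr (Equiv.refl (Fin t.length))).trans e₃))
  refine ⟨p₂, q₂, ⟨e₂.symm.trans (e'.trans e₄), ?_, e₂ (Sum.inr (e₁ (Sum.inl i))), ?_⟩,
    head₂, last₂.trans last₁, head₄, last₄.trans last₃⟩
  · intro i
    obtain ⟨i, rfl⟩ := e₂.surjective i
    rcases i with i | i
    · simpa [e', pair₂, pair₄] using hr (stepPair s i) (s.step i)
    obtain ⟨i, rfl⟩ := e₁.surjective i
    rcases i with i | i
    · simpa [e', pair₁, pair₂, pair₃, pair₄] using related i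
    · simpa [e', pair₁, pair₂, pair₃, pair₄] using hr (stepPair t i) (t.step i)
  · simp [pair₂, pair₄, pair₁, pair₃, e', marked]

/-- The chains are `b₀ < ⋯ < bₙ < y` and `z < f b₀ < ⋯ < f bₙ`, and the last step of the first is
paired with the first step of the second. -/
lemma exists_stepsMatched_of_covBy (b : RelSeries {(a, b) : α × α | a ⋖ b}) (f : α → α) {y z : α}
    (hy : b.last ⋖ y) (hz : z ⋖ f b.head)
    (hf : ∀ i : Fin b.length, f (b i.castSucc) ⋖ f (b i.succ))
    (related : ∀ i : Fin b.length, r (stepPair b i) (f (b i.castSucc), f (b i.succ)))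
    (related_last : r (b.last, y) (z, f b.head)) (marked : m (b.last, y) (z, f b.head)) :
    ∃ p q, StepsMatched r m p q ∧ p.head = b.head ∧ p.last = y ∧ q.head = z ∧
      q.last = f b.last := by
  let top : RelSeries {(a, b) : α × α | a ⋖ b} := ⟨1, ![b.last, y], fun | 0 => hy⟩
  let bottom : RelSeries {(a, b) : α × α | a ⋖ b} := ⟨1, ![z, f b.head], fun | 0 => hz⟩
  obtain ⟨p, hp, hp', e, he⟩ := exists_smash (p := b) (q := top) rfl
  obtain ⟨q, hq, hq', e', he'⟩ := exists_smash (p := bottom) (q := ⟨b.length, f ∘ b, hf⟩) rfl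
  refine ⟨p, q, ⟨e.symm.trans ((Equiv.sumComm _ _).trans e'), fun i => ?_, e (Sum.inr 0), ?_⟩,
    hp, hp', hq, hq'⟩
  · obtain ⟨s, rfl⟩ := e.surjective i
    rw [Equiv.trans_apply, Equiv.symm_apply_apply, Equiv.trans_apply, he, he']
    match s with
    | .inl i => exact related i
    | .inr 0 => exact related_last
  · rw [Equiv.trans_apply, Equiv.symm_apply_apply, Equiv.trans_apply, he, he']
    exact marked

end MatchedSeries

section CCPrimeType

variable {L : Type*} [LieRing L] [LieAlgebra k L] {I C X N : LieIdeal k L}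
variable {A : Type*} [LieRing A] [LieAlgebra k A] {θ : L →ₗ⁅k⁆ LieDerivation k A A}

lemma isCCPrimeType_of_stepsMatched {p q : RelSeries {(a, b) : LieIdeal k L × LieIdeal k L | a ⋖ b}}
    (h : StepsMatched (fun x y => MRelated x.2 x.1 y.2 y.1)
      (fun x y => IsMPrimeFactor x.2 x.1 ∧ IsMPrimeFactor y.2 y.1 ∧
        (IsMixedPair x.2 x.1 y.2 y.1 ∨ IsMixedPair y.2 y.1 x.2 x.1) ∧
        LEquivalent θ (factorAction x.2 x.1)) p q)
    (hp : p.head = ⊥) (hp' : p.last = ⊤) (hq : q.head = ⊥) (hq' : q.last = ⊤) :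
    IsCCPrimeType θ := by
  obtain ⟨n, X, hX⟩ := p
  obtain ⟨n', Y, hY⟩ := q
  obtain ⟨e, related, marked⟩ := h
  obtain rfl : n = n' := Fin.equiv_iff_eq.1 ⟨e⟩
  exact ⟨n, X, Y, e, ⟨hp, hp', fun i => isChiefFactor_iff_covBy.2 (hX i)⟩,
    ⟨hq, hq', fun i => isChiefFactor_iff_covBy.2 (hY i)⟩, related, marked⟩

lemma IsMixedPair.exists_isTwist {H₁ K₁ H₂ K₂ : LieIdeal k L}
    (h : IsMixedPair H₁ K₁ H₂ K₂)
    (hm : IsMPrimeFactor H₂ K₂) (he : LEquivalent θ (factorAction H₂ K₂)) :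
    ∃ C, C ≤ innerIdeal θ ∧ LEquivalent θ (factorAction (innerIdeal θ) C) ∧
      IsCPrimeFactor (innerIdeal θ) C ∧
      ∃ δ : L →ₗ⁅k⁆ L ⧸ C, IsTwist (innerIdeal θ) C δ ∧ ¬ Function.Surjective δ := by
  obtain ⟨-, -, -, -, B₁, B₀, -, -, -, I, C, X, N, ⟨hI, -⟩, ⟨-, hc'⟩,
    ⟨-, -, hXA, hIX, hc⟩, -⟩ := h
  rw [← he.innerIdeal_eq] at hI
  subst hI
  exact ⟨C, hc'.1.1, (he.trans hXA.lEquivalent).trans hIX.lEquivalent, hc',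
    hIX.exists_isTwist_not_surjective hXA hc hm⟩

lemma crownBottom_lt_innerIdeal_iff (hirr : IsIrreducibleLAlgebra θ) (hA : ¬ IsLieAbelian A) :
    crownBottom θ < innerIdeal θ ↔ (crownKernels θ).Nonempty := by
  constructor
  · contrapose!
    intro empty
    rw [crownBottom, empty, sInf_empty]
    exact not_top_lt
  · rintro ⟨C, hC⟩
    exact (sInf_le hC).trans_lt
      (isSelfCentralizingFactor_of_mem_crownKernels hirr hA hC).covBy.lt

variable [FiniteDimensional k L]

lemma Covers.exists_stepsMatched
    {m : LieIdeal k L × LieIdeal k L → LieIdeal k L × LieIdeal k L → Prop}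
    (h : Covers I C X N) (hI : IsChiefFactor I C) (hn : IsNonabelianFactor X N)
    (marked : m (C, I) (N, X)) :
    ∃ p q, StepsMatched (fun x y => MRelated x.2 x.1 y.2 y.1) m p q ∧
      p.head = ⊥ ∧ p.last = ⊤ ∧ q.head = ⊥ ∧ q.last = ⊤ := by
  have := LieSubmodule.wellFoundedLT_of_isArtinian k L L
  have hCI := isChiefFactor_iff_covBy.1 hI
  have hNX := h.covBy_iff.1 hCI
  have related : MRelated I C X N := Or.inl ⟨I, C, hI.isSupplementedChiefFactor
    (not_isFrattiniFactor hI (h.isNonabelianFactor_iff.2 hn)), Covers.refl hI.1, h⟩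
  obtain rfl : X ⊓ C = N := inf_comm X C ▸ h.2
  obtain rfl : I = X ⊔ C := h.1.trans (sup_comm C X)
  obtain ⟨b, hb, hb'⟩ := exists_relSeries_covBy (inf_le_right : X ⊓ C ≤ C)
  obtain ⟨s, hs, hs'⟩ := exists_relSeries_covBy (bot_le : ⊥ ≤ X ⊓ C)
  obtain ⟨t, ht, ht'⟩ := exists_relSeries_covBy (le_top : X ⊔ C ≤ ⊤)
  have mono : Monotone b := (Fin.strictMono_iff_lt_succ.2 fun i => (b.step i).lt).monotone
  have step (i : Fin b.length) := mRelated_sup hNX hn (hb.ge.trans (mono (Fin.zero_le _)))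
    (b.step i) ((mono (Fin.le_last _)).trans hb'.le)
  have sup_head : X ⊔ b.head = X := by rw [hb, sup_inf_self]
  obtain ⟨p, q, matched, hp, hp', hq, hq'⟩ := exists_stepsMatched_of_covBy
    (r := fun x y => MRelated x.2 x.1 y.2 y.1) (m := m) (y := X ⊔ C) (z := X ⊓ C) b (X ⊔ ·)
    (by rwa [hb']) (by rwa [sup_head]) (fun i => (step i).1) (fun i => (step i).2)
    (by rwa [hb', sup_head]) (by rwa [hb', sup_head])
  obtain ⟨p', q', matched', hp₁, hp₂, hq₁, hq₂⟩ := matched.exists_smash_smash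
    (fun x hx => MRelated.refl (isChiefFactor_iff_covBy.2 hx))
    (hs'.trans (hb.symm.trans hp.symm)) (hp'.trans ht.symm) (hs'.trans hq.symm)
    (hq'.trans ((congrArg (X ⊔ ·) hb').trans ht.symm))
  exact ⟨p', q', matched', hp₁.trans hs, hp₂.trans ht', hq₁.trans hs, hq₂.trans ht'⟩

lemma IsMixedPair.isCCPrimeType (h : IsMixedPair I C X N) (hIX : Covers I C X N)
    (hI : IsMPrimeFactor I C) (hX : IsMPrimeFactor X N)
    (he : LEquivalent θ (factorAction I C)) : IsCCPrimeType θ := by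
  obtain ⟨p, q, matched, hp, hp', hq, hq'⟩ :=
    hIX.exists_stepsMatched hI.1 h.2.1 (m := fun x y => IsMPrimeFactor x.2 x.1 ∧
      IsMPrimeFactor y.2 y.1 ∧ (IsMixedPair x.2 x.1 y.2 y.1 ∨ IsMixedPair y.2 y.1 x.2 x.1) ∧
      LEquivalent θ (factorAction x.2 x.1)) ⟨hI, hX, Or.inl h, he⟩
  exact isCCPrimeType_of_stepsMatched matched hp hp' hq hq'

lemma isCCPrimeType_iff (hirr : IsIrreducibleLAlgebra θ) (hA : ¬ IsLieAbelian A) :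
    IsCCPrimeType θ ↔ ∃ C ∈ crownKernels θ, IsCPrimeFactor (innerIdeal θ) C ∧
      ∃ δ : L →ₗ⁅k⁆ L ⧸ C, IsTwist (innerIdeal θ) C δ ∧ ¬ Function.Surjective δ := by
  constructor
  · rintro ⟨n, X, Y, π, -, -, -, i, hmX, hmY, mixed, he⟩
    simp only [mem_crownKernels_iff hirr hA, and_assoc]
    rcases mixed with mixed | mixed
    · obtain ⟨-, -, -, -, B₁, B₀, -, covers_X, covers_Y, -⟩ := id mixed
      exact mixed.exists_isTwist hmY
        ((he.trans covers_X.lEquivalent).trans covers_Y.lEquivalent.symm)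
    · exact mixed.exists_isTwist hmX he
  · rintro ⟨C, hC, hc', δ, hδ, not_surj⟩
    have hI := isSelfCentralizingFactor_of_mem_crownKernels hirr hA hC
    exact (hδ.isMixedPair hI hc' not_surj).isCCPrimeType (hδ.covers_ker hI.covBy not_surj)
      ⟨hc'.1, fun ⟨M, _, hM⟩ => hc'.2 ⟨M, hM⟩⟩ (hδ.isMPrimeFactor_ker hc' not_surj) hC.2.1

lemma isCCPrimeType_iff_of_mem_crownKernels (hirr : IsIrreducibleLAlgebra θ)
    (hA : ¬ IsLieAbelian A) (hC : C ∈ crownKernels θ) :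
    IsCCPrimeType θ ↔ cocycleCore θ < crownBottom θ ∧ IsCPrimeFactor (innerIdeal θ) C := by
  rw [isCCPrimeType_iff hirr hA]
  constructor
  · rintro ⟨R, hR, hc', twist⟩
    exact ⟨(cocycleCore_lt_crownBottom_iff hirr hA hR hc').2 twist,
      (isCPrimeFactor_iff_of_mem_crownKernels hirr hA hC hR).1 hc'⟩
  · rintro ⟨hE, hc'⟩
    exact ⟨C, hC, hc', (cocycleCore_lt_crownBottom_iff hirr hA hC hc').1 hE⟩

lemma isCPrimeFactor_socle_iff_of_mem_crownKernels (hirr : IsIrreducibleLAlgebra θ)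
    (hA : ¬ IsLieAbelian A) {R : LieIdeal k L} (hC : C ∈ crownKernels θ)
    (hR : R ∈ crownKernels θ) :
    IsCPrimeFactor (socle k (L ⧸ R)) ⊥ ↔ IsCPrimeFactor (innerIdeal θ) C :=
  (isSelfCentralizingFactor_of_mem_crownKernels hirr hA hR).isCPrimeFactor_socle_iff.trans
    (isCPrimeFactor_iff_of_mem_crownKernels hirr hA hC hR)

end CCPrimeType

end CCType

theorem mainTheorem1 {k : Type*} [Field k]
    {L : Type*} [LieRing L] [LieAlgebra k L] [FiniteDimensional k L]
    {A : Type*} [LieRing A] [LieAlgebra k A] (θ : L →ₗ⁅k⁆ LieDerivation k A A)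
    (hirr : CCType.IsIrreducibleLAlgebra θ) (hA : ¬ IsLieAbelian A) :
    (CCType.IsCCPrimeType θ ↔
      CCType.cocycleCore θ < CCType.crownBottom θ ∧
      CCType.crownBottom θ < CCType.innerIdeal θ ∧
      ∃ R : LieIdeal k L, CCType.IsCorrespondingPrimitive θ R ∧
        CCType.IsCPrimeFactor (CCType.socle k (L ⧸ R)) ⊥) ∧
    (CCType.IsCCPrimeType θ ↔
      CCType.cocycleCore θ < CCType.crownBottom θ ∧
      CCType.crownBottom θ < CCType.innerIdeal θ ∧
      ∀ R : LieIdeal k L, CCType.IsCorrespondingPrimitive θ R →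
        CCType.IsCPrimeFactor (CCType.socle k (L ⧸ R)) ⊥) := by
  by_cases nonempty : (CCType.crownKernels θ).Nonempty
  · obtain ⟨C, hC⟩ := nonempty
    have hP : CCType.IsCorrespondingPrimitive θ C :=
      ⟨hC, (CCType.isSelfCentralizingFactor_of_mem_crownKernels hirr hA hC).isPrimitive⟩
    have hD := (CCType.crownBottom_lt_innerIdeal_iff hirr hA).2 ⟨C, hC⟩
    have socle_iff (R : LieIdeal k L) (hR : CCType.IsCorrespondingPrimitive θ R) :=
      CCType.isCPrimeFactor_socle_iff_of_mem_crownKernels hirr hA hC hR.1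
    rw [CCType.isCCPrimeType_iff_of_mem_crownKernels hirr hA hC]
    exact ⟨⟨fun ⟨hE, hc'⟩ => ⟨hE, hD, C, hP, (socle_iff C hP).2 hc'⟩,
        fun ⟨hE, _, R, hR, hc'⟩ => ⟨hE, (socle_iff R hR).1 hc'⟩⟩,
      ⟨fun ⟨hE, hc'⟩ => ⟨hE, hD, fun R hR => (socle_iff R hR).2 hc'⟩,
        fun ⟨hE, _, hc'⟩ => ⟨hE, (socle_iff C hP).1 (hc' C hP)⟩⟩⟩
  · have not_lt := mt (CCType.crownBottom_lt_innerIdeal_iff hirr hA).1 nonempty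
    have not_type : ¬ CCType.IsCCPrimeType θ := fun h =>
      let ⟨C, hC, _⟩ := (CCType.isCCPrimeType_iff hirr hA).1 h
      nonempty ⟨C, hC⟩
    exact ⟨iff_of_false not_type fun h => not_lt h.2.1,
      iff_of_false not_type fun h => not_lt h.2.1⟩
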